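/- Let $V=\mathbb C^{\ell}$ and let $W\subseteq \mathrm{GL}(V)$ be one of the following finite complex reflection groups, up to linear conjugacy: * the monomial group $G(r,r,\ell)$ with $r\ge 3$ and $\ell\ge 5$, i.e. the group of all monomial $\ell\times\ell$ matrices whose nonzero entries are $r$-th roots of unity with product $1$; * the exceptional group $G_{33}$ of the Shephard–Todd classification ($\ell=5$), or the exceptional group $G_{34}$ ($\ell=6$), each in its reflection representation. Explicitly, put $\omega=e^{2\pi i/3}$. The group $G_{34}$ is generated by the unitary reflections of order $2$ in the hyperplanes orthogonal to the vectors $e_i-\zeta e_j$ ($i\ne j$, $\zeta^3=1$) and to the vectors $(\zeta_1,\dots,\zeta_6)$ with $\zeta_i^3=1$ for all $i$ and $\prod_i\zeta_i=1$. The group $G_{33}$ is generated by the unitary reflections of order $2$ in the hyperplanes orthogonal to $e_1,\dots,e_5$ and to all vectors obtained by arbitrary sign changes of the entries from the rows of $$\begin{pmatrix}0&1&1&1&1\\1&0&1&\omega&\omega^2\\1&1&0&\omega^2&\omega\\1&\omega&\omega^2&0&1\\1&\omega^2&\omega&1&0\end{pmatrix}.$$ Let $\mathcal A(W)$ be the reflection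 arrangement of $W$, i.e. the set of reflecting hyperplanes (fixed point spaces) of the reflections contained in $W$, and let $L(\mathcal A(W))$ be the set of all intersections of members of $\mathcal A(W)$, including the empty intersection $V$. The rank of $X\in L(\mathcal A(W))$ is $\operatorname{codim}_V X$, and $X$ is called modular if $X+Y\in L(\mathcal A(W))$ for every $Y\in L(\mathcal A(W))$. Then $L(\mathcal A(W))$ has no modular element of rank $2$. -/

import Mathlib

open Module

noncomputable section

namespace ReflectionArrangement

section Arrangements

variable {V : Type*} [AddCommGroup V] [Module ℂ V]

/-- The fixed point subspace `Fix(g)` of `g ∈ GL(V)`. -/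
def fixedSpace (g : V ≃ₗ[ℂ] V) : Submodule ℂ V :=
  LinearMap.eqLocus (g : V →ₗ[ℂ] V) LinearMap.id

/-- A (complex) reflection: an element of finite order of `GL(V)` whose fixed point subspace is
a hyperplane. -/
def IsReflection (g : V ≃ₗ[ℂ] V) : Prop :=
  IsOfFinOrder g ∧ finrank ℂ (V ⧸ fixedSpace g) = 1

/-- The reflection arrangement `𝒜(W)`: the reflecting hyperplanes of all the reflections which
belong to the group `W`. -/
def reflectionArrangement (W : Subgroup (V ≃ₗ[ℂ] V)) : Set (Submodule ℂ V) :=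
  {H | ∃ g ∈ W, IsReflection g ∧ fixedSpace g = H}

/-- The set `L(𝒜)` of all intersections of members of `𝒜`; the empty intersection is `V`. -/
def intersectionLattice (A : Set (Submodule ℂ V)) : Set (Submodule ℂ V) :=
  {X | ∃ B ⊆ A, X = sInf B}

/-- `X ∈ L(𝒜)` is modular if `X + Y ∈ L(𝒜)` for every `Y ∈ L(𝒜)`. -/
def IsModularElement (A : Set (Submodule ℂ V)) (X : Submodule ℂ V) : Prop :=
  X ∈ intersectionLattice A ∧ ∀ Y ∈ intersectionLattice A, X ⊔ Y ∈ intersectionLattice A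

/-- The rank of a member of `L(𝒜)` is its codimension in `V`. -/
def rank (X : Submodule ℂ V) : ℕ := finrank ℂ (V ⧸ X)

/-- `W ≤ GL(V)` and `W' ≤ GL(V')` are the same linear group up to the choice of a basis: some
linear isomorphism `V ≃ V'` conjugates `W` to `W'`. -/
def IsLinearlyConjugate {V' : Type*} [AddCommGroup V'] [Module ℂ V']
    (W : Subgroup (V ≃ₗ[ℂ] V)) (W' : Subgroup (V' ≃ₗ[ℂ] V')) : Prop :=
  ∃ e : V ≃ₗ[ℂ] V', ∀ g : V ≃ₗ[ℂ] V, g ∈ W ↔ (e.symm.trans g).trans e ∈ W'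

end Arrangements

section Groups

/-- The monomial group `G(r,r,ℓ)` on `ℂ^ℓ`: all monomial matrices whose nonzero entries are
`r`-th roots of unity with product `1`. -/
def monomialGroup (r l : ℕ) :
    Subgroup (EuclideanSpace ℂ (Fin l) ≃ₗ[ℂ] EuclideanSpace ℂ (Fin l)) where
  carrier := {g | ∃ (σ : Equiv.Perm (Fin l)) (θ : Fin l → ℂ),
    (∀ i, θ i ^ r = 1) ∧ ∏ i, θ i = 1 ∧ ∀ x i, g x i = θ i * x (σ i)}
  mul_mem' := by
    rintro g h ⟨σ, θ, h1, h2, h3⟩ ⟨τ, η, k1, k2, k3⟩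
    refine ⟨σ.trans τ, fun i => θ i * η (σ i), fun i => ?_, ?_, fun x i => ?_⟩
    · rw [mul_pow, h1, k1, one_mul]
    · rw [Finset.prod_mul_distrib, h2, Equiv.prod_comp σ η, k2, one_mul]
    · rw [LinearEquiv.mul_apply, h3, k3, mul_assoc, Equiv.trans_apply]
  one_mem' := ⟨1, fun _ => 1, fun _ => one_pow r, by simp, fun x i => by simp⟩
  inv_mem' := by
    rintro g ⟨σ, θ, h1, h2, h3⟩
    have h0 : ∀ i, θ i ≠ 0 := fun i hi => by
      rw [Finset.prod_eq_zero (Finset.mem_univ i) hi] at h2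
      exact zero_ne_one h2
    refine ⟨σ.symm, fun i => (θ (σ.symm i))⁻¹, fun i => ?_, ?_, fun x i => ?_⟩
    · rw [inv_pow, h1, inv_one]
    · rw [Equiv.prod_comp σ.symm (fun i => (θ i)⁻¹), Finset.prod_inv_distrib, h2, inv_one]
    · have h := h3 (g⁻¹ x) (σ.symm i)
      have hx : g (g⁻¹ x) = x := LinearEquiv.apply_symm_apply g x
      rw [hx, Equiv.apply_symm_apply] at h
      rw [h, inv_mul_cancel_left₀ (h0 _)]

/-- The group generated by the unitary reflections of order two in the hyperplanes orthogonal to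
the nonzero vectors in `R`. -/
def reflectionGroup {n : ℕ} (R : Set (EuclideanSpace ℂ (Fin n))) :
    Subgroup (EuclideanSpace ℂ (Fin n) ≃ₗ[ℂ] EuclideanSpace ℂ (Fin n)) :=
  Subgroup.closure {g | ∃ v ∈ R, v ≠ 0 ∧ g = (Submodule.reflection (ℂ ∙ v)ᗮ).toLinearEquiv}

/-- The primitive cube root of unity `exp(2πi/3)`. -/
def ω : ℂ := Complex.exp (2 * Real.pi * Complex.I / 3)

/-- The exponents of `ω` in the nonzero off-diagonal entries of the generalized weighing matrix
`(0,1,1,1,1; 1,0,1,ω,ω²; 1,1,0,ω²,ω; 1,ω,ω²,0,1; 1,ω²,ω,1,0)`. -/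
def phase : Matrix (Fin 5) (Fin 5) ℕ :=
  !![0, 0, 0, 0, 0;
     0, 0, 0, 1, 2;
     0, 0, 0, 2, 1;
     0, 1, 2, 0, 0;
     0, 2, 1, 0, 0]

/-- Vectors spanning the 45 lines of the line system `K₅`: the 5 coordinate vectors, and for each
of the 5 coordinates `k` the 16 vectors (8 lines) which vanish at `k` and whose entry at
`i ≠ k` is `± ω ^ (phase k i)` with independent signs. -/
def rootsK5 : Set (EuclideanSpace ℂ (Fin 5)) :=
  {v | ∃ k, v = EuclideanSpace.single k 1} ∪
  {v | ∃ (k : Fin 5) (ε : Fin 5 → ℤˣ),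
    v k = 0 ∧ ∀ i, i ≠ k → v i = ((ε i : ℤ) : ℂ) * ω ^ phase k i}

/-- Vectors spanning the 126 lines of the line system `K₆`: the vectors `e_i - ζ e_j` with
`i ≠ j` and `ζ` a cube root of unity (45 lines), and the vectors all of whose entries are cube
roots of unity, with product `1` (243 vectors, 81 lines). -/
def rootsK6 : Set (EuclideanSpace ℂ (Fin 6)) :=
  {v | ∃ (i j : Fin 6) (ζ : ℂ), i ≠ j ∧ ζ ^ 3 = 1 ∧
    v = EuclideanSpace.single i 1 - EuclideanSpace.single j ζ} ∪
  {v | (∀ i, v i ^ 3 = 1) ∧ ∏ i, v i = 1}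

/-- The exceptional complex reflection group `G₃₃` (rank 5, order 51840), the group of the line
system `K₅`. -/
def G33 : Subgroup (EuclideanSpace ℂ (Fin 5) ≃ₗ[ℂ] EuclideanSpace ℂ (Fin 5)) :=
  reflectionGroup rootsK5

/-- The exceptional complex reflection group `G₃₄` (rank 6, order 39191040), the group of the line
system `K₆`. -/
def G34 : Subgroup (EuclideanSpace ℂ (Fin 6) ≃ₗ[ℂ] EuclideanSpace ℂ (Fin 6)) :=
  reflectionGroup rootsK6

end Groups

end ReflectionArrangement

end

noncomputable section

namespace ReflectionArrangement

/-! ### Arithmetic of the Eisenstein integers -/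

section Eisenstein

open ComplexConjugate

/-! Suppose `X` is modular of rank 2 and let `ℂ y` be a line in the intersection lattice. Then `X +
ℂ y` is a proper subspace in the lattice, so some hyperplane of the arrangement contains both `X`
and `y` (`IsModularElement.exists_mem`). Dually, the plane `P = Xᗮ` contains, for every such `y`, a
normal vector of the arrangement orthogonal to `y`. The proof chooses a few lines `y` for which no
plane can meet all these demands.

For `G(r,r,n)` and `G₃₄` one argument suffices (`not_exists_modular_of_monomial`): the only normals
with a zero entry are proportional to `e_j - ζ e_k`. The coordinate vectors put two independent such
normals into `P`; a vector of `r`-th roots of unity then demands a combination of them with at least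
three nonzero entries, and `n ≥ 5` leaves it a zero entry. For `G₃₃` the normals have one or exactly
four nonzero entries, and lines inside coordinate planes give the contradiction
(`not_exists_modular_G33`).

The exceptional groups are given by generators, so the hyperplanes of all their reflections must be
controlled. The group preserves a lattice over the Eisenstein integers, and a shortest lattice
vector normal to a reflecting hyperplane is short in absolute terms
(`exists_normal_of_isReflection`). Divisibility conditions on short lattice vectors then determine
the possible supports (`exists_eq_smul_single_sub_single`, `support_of_normal_K5`). -/

theorem isPrimitiveRoot_omega : IsPrimitiveRoot ω 3 := by
  have h := Complex.isPrimitiveRoot_exp 3 (by norm_num)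
  simpa [ω] using h

theorem omega_sq : ω ^ 2 = -1 - ω := by
  have h1 : ω ^ 3 = 1 := isPrimitiveRoot_omega.pow_eq_one
  have h2 : ω ≠ 1 := isPrimitiveRoot_omega.ne_one (by norm_num)
  have h3 : (ω - 1) * (ω ^ 2 + ω + 1) = 0 := by linear_combination h1
  rcases mul_eq_zero.1 h3 with h | h
  · exact absurd (sub_eq_zero.1 h) h2
  · linear_combination h

theorem omega_ne_zero : ω ≠ 0 := isPrimitiveRoot_omega.ne_zero (by norm_num)

theorem conj_omega : conj ω = -1 - ω := by
  have h1 : ‖ω‖ = 1 := isPrimitiveRoot_omega.norm'_eq_one (by norm_num)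
  have h2 : ω * conj ω = 1 := by rw [Complex.mul_conj', h1]; norm_num
  have h3 : ω * (-1 - ω) = 1 := by linear_combination -omega_sq
  exact mul_left_cancel₀ omega_ne_zero (h2.trans h3.symm)

theorem omega_re : ω.re = -1 / 2 := by
  have h := congrArg Complex.re conj_omega
  simp at h
  linarith

theorem omega_im_sq : ω.im ^ 2 = 3 / 4 := by
  have h := congrArg Complex.re omega_sq
  simp [pow_two, omega_re] at h
  linarith

theorem omega_im_ne_zero : ω.im ≠ 0 := fun h => by
  have := omega_im_sq
  rw [h] at this
  norm_num at this

/-- The ring of Eisenstein integers, as a subring of `ℂ`. -/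
def eisenstein : Subring ℂ where
  carrier := {z | ∃ a b : ℤ, z = a + b * ω}
  mul_mem' := by
    rintro _ _ ⟨a, b, rfl⟩ ⟨c, d, rfl⟩
    refine ⟨a * c - b * d, a * d + b * c - b * d, ?_⟩
    push_cast
    linear_combination (b * d : ℂ) * omega_sq
  one_mem' := ⟨1, 0, by simp⟩
  add_mem' := by
    rintro _ _ ⟨a, b, rfl⟩ ⟨c, d, rfl⟩
    exact ⟨a + c, b + d, by push_cast; ring⟩
  zero_mem' := ⟨0, 0, by simp⟩
  neg_mem' := by
    rintro _ ⟨a, b, rfl⟩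
    exact ⟨-a, -b, by push_cast; ring⟩

theorem omega_mem : ω ∈ eisenstein := ⟨0, 1, by simp⟩

theorem conj_mem {z : ℂ} (hz : z ∈ eisenstein) : conj z ∈ eisenstein := by
  obtain ⟨a, b, rfl⟩ := hz
  refine ⟨a - b, -b, ?_⟩
  simp only [map_add, map_mul, conj_omega, map_intCast]
  push_cast
  ring

theorem norm_sq_add_mul_omega (x y : ℝ) :
    ‖(x + y * ω : ℂ)‖ ^ 2 = x ^ 2 - x * y + y ^ 2 := by
  rw [← Complex.normSq_eq_norm_sq, Complex.normSq_apply]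
  simp [omega_re]
  linear_combination y ^ 2 * omega_im_sq

/-- The prime 2 is inert: `a² - ab + b²` is even only when `a` and `b` both are. The divisibility by
4 is what excludes entries of norm 2 for `G₃₃`. -/
theorem exists_norm_sq_eq {z : ℂ} (hz : z ∈ eisenstein) :
    ∃ n : ℕ, ‖z‖ ^ 2 = n ∧ (Even n → 4 ∣ n) := by
  obtain ⟨a, b, rfl⟩ := hz
  have h := norm_sq_add_mul_omega a b
  have h0 : 0 ≤ a ^ 2 - a * b + b ^ 2 := by nlinarith [sq_nonneg (a - b), sq_nonneg a, sq_nonneg b]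
  obtain ⟨n, hn⟩ := Int.eq_ofNat_of_zero_le h0
  refine ⟨n, ?_, fun he => ?_⟩
  · have : ((a ^ 2 - a * b + b ^ 2 : ℤ) : ℝ) = n := by rw [hn]; simp
    push_cast at h this ⊢
    rw [← this, ← h]
  · have he' : Even (a ^ 2 - a * b + b ^ 2) := by rw [hn]; exact_mod_cast he
    have hab : Even a ∧ Even b := by
      simp only [Int.even_add, Int.even_sub, Int.even_mul, Int.even_pow] at he'
      tauto
    obtain ⟨⟨c, rfl⟩, ⟨d, rfl⟩⟩ := hab
    have : (4 : ℤ) ∣ (n : ℤ) := ⟨c ^ 2 - c * d + d ^ 2, by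
      rw [← hn]; ring⟩
    exact_mod_cast this

theorem one_le_norm_sq {z : ℂ} (hz : z ∈ eisenstein) (h0 : z ≠ 0) : 1 ≤ ‖z‖ ^ 2 := by
  obtain ⟨n, hn, -⟩ := exists_norm_sq_eq hz
  have : 0 < ‖z‖ ^ 2 := by positivity
  rw [hn] at this ⊢
  exact_mod_cast this

/-- Rounding both coordinates in the basis `1, ω` leaves a squared error of at most `3/4`. This
Euclidean property later shows that a rank-one lattice is generated by a shortest vector. -/
theorem exists_near (z : ℂ) : ∃ q ∈ eisenstein, ‖z - q‖ < 1 := by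
  obtain ⟨x, y, rfl⟩ : ∃ x y : ℝ, z = x + y * ω := by
    refine ⟨z.re + z.im / ω.im / 2, z.im / ω.im, ?_⟩
    have := omega_im_ne_zero
    apply Complex.ext
    · simp [omega_re]; ring
    · simp; field_simp
  refine ⟨(round x : ℤ) + (round y : ℤ) * ω, ⟨_, _, rfl⟩, ?_⟩
  have h := norm_sq_add_mul_omega (x - round x) (y - round y)
  have e : ((x : ℂ) + y * ω - ((round x : ℤ) + (round y : ℤ) * ω)) =
    ((x - round x : ℝ) : ℂ) + ((y - round y : ℝ) : ℂ) * ω := by push_cast; ring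
  rw [e]
  have hx := abs_le.1 (abs_sub_round x)
  have hy := abs_le.1 (abs_sub_round y)
  set a := x - round x
  set b := y - round y
  have h1 : a ^ 2 ≤ 1 / 4 := by nlinarith
  have h2 : b ^ 2 ≤ 1 / 4 := by nlinarith
  have h3 : ‖(a + b * ω : ℂ)‖ ^ 2 < 1 := by
    rw [h]; nlinarith [sq_nonneg (a + b)]
  nlinarith [norm_nonneg (a + b * ω : ℂ)]

theorem eq_intCast_of_ofReal_mem {x : ℝ} (hx : (x : ℂ) ∈ eisenstein) : ∃ m : ℤ, x = m := by
  obtain ⟨a, b, h⟩ := hx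
  have him := congrArg Complex.im h
  have hre := congrArg Complex.re h
  simp at him hre
  rcases him with h0 | h0
  · exact ⟨a, by simpa [h0] using hre⟩
  · exact absurd h0 omega_im_ne_zero

theorem norm_one_sub_omega_sq : ‖1 - ω‖ ^ 2 = 3 := by
  have := norm_sq_add_mul_omega 1 (-1)
  norm_num at this
  rw [← this]; congr 2

theorem one_sub_omega_ne_zero : 1 - ω ≠ 0 := fun h => by
  have := norm_one_sub_omega_sq
  simp [h] at this

theorem conj_one_sub_omega_mul : conj (1 - ω) * (1 - ω) = 3 := by
  simp only [map_sub, map_one, conj_omega]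
  linear_combination -omega_sq

theorem cube_root_cases {z : ℂ} (hz : z ^ 3 = 1) : z = 1 ∨ z = ω ∨ z = ω ^ 2 := by
  obtain ⟨i, hi, rfl⟩ := isPrimitiveRoot_omega.eq_pow_of_pow_eq_one hz
  interval_cases i <;> simp

theorem cube_root_mem {z : ℂ} (hz : z ^ 3 = 1) : z ∈ eisenstein := by
  rcases cube_root_cases hz with rfl | rfl | rfl
  exacts [one_mem _, omega_mem, pow_mem omega_mem 2]

theorem cube_root_sub_one_div_mem {z : ℂ} (hz : z ^ 3 = 1) :
    (z - 1) / (1 - ω) ∈ eisenstein := by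
  have h := one_sub_omega_ne_zero
  rcases cube_root_cases hz with rfl | rfl | rfl
  · simp [zero_mem]
  · rw [show (ω - 1) / (1 - ω) = -1 by field_simp; ring]
    exact neg_mem (one_mem _)
  · rw [show (ω ^ 2 - 1) / (1 - ω) = -(1 + ω) by field_simp; ring]
    exact neg_mem (add_mem (one_mem _) omega_mem)

/-- Since `1 - ω` divides `z - 1` for each cube root of unity and `(1 - ω)² = -3ω`, the product `(z
- 1)(z' - 1)` vanishes modulo 3; hence `z ↦ z - 1` turns products into sums modulo 3. -/
theorem sum_cube_roots_div_mem {ι : Type*} (s : Finset ι) (z : ι → ℂ) (hz : ∀ i, z i ^ 3 = 1) :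
    (∏ i ∈ s, z i - 1 - ∑ i ∈ s, (z i - 1)) / 3 ∈ eisenstein := by
  classical
  induction s using Finset.induction_on with
  | empty => simp [zero_mem]
  | insert a s ha ih =>
    rw [Finset.prod_insert ha, Finset.sum_insert ha]
    have h1 := cube_root_sub_one_div_mem (hz a)
    have h2 := cube_root_sub_one_div_mem (z := ∏ i ∈ s, z i) (by simp [← Finset.prod_pow, hz])
    have h3 := neg_mem (mul_mem omega_mem (mul_mem h1 h2))
    have h4 := add_mem ih h3
    convert h4 using 1
    have h := one_sub_omega_ne_zero
    have h5 : (1 - ω) ^ 2 = -3 * ω := by linear_combination omega_sq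
    have h6 : ω ≠ 0 := omega_ne_zero
    rw [div_mul_div_comm, ← pow_two, h5]
    field_simp
    ring

end Eisenstein

/-! ### Reflections preserving an Eisenstein lattice -/

section Lattice

open ComplexConjugate

local notation "⟪" x ", " y "⟫" => inner ℂ x y

variable {n : ℕ}

/-- Rescaling the root to norm `2 * s` makes the coefficient `⟪r, x⟫ / s`, the quantity whose
integrality defines the invariant lattice. -/
theorem reflection_orthogonal_singleton_apply {s : ℕ} {v r : EuclideanSpace ℂ (Fin n)} {c : ℂ}
    (hc : c ≠ 0) (hr : r = c • v) (hs : ⟪r, r⟫ = 2 * s) (x : EuclideanSpace ℂ (Fin n)) :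
    (Submodule.reflection (ℂ ∙ v)ᗮ) x = x - (⟪r, x⟫ / s) • r := by
  have h : (ℂ ∙ v) = (ℂ ∙ r) := by
    rw [hr, Submodule.span_singleton_smul_eq (IsUnit.mk0 c hc)]
  have h2 : ((‖r‖ : ℂ)) ^ 2 = 2 * s := by
    rw [← hs, inner_self_eq_norm_sq_to_K]; rfl
  simp only [h]
  rw [Submodule.reflection_orthogonal_apply, Submodule.reflection_singleton_apply]
  simp only [Complex.coe_algebraMap, h2]
  rw [← Nat.cast_smul_eq_nsmul ℂ, smul_smul, neg_sub]
  congr 2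
  push_cast
  field_simp

theorem mem_fixedSpace {V : Type*} [AddCommGroup V] [Module ℂ V] {g : V ≃ₗ[ℂ] V} {x : V} :
    x ∈ fixedSpace g ↔ g x = x := Iff.rfl

/-- An isometry whose fixed space is a hyperplane acts as `x ↦ x - (1 - η) ⟪v, x⟫ / ⟪v, v⟫ • v`
for every normal vector `v` of this hyperplane. -/
theorem exists_sub_apply_eq {g : EuclideanSpace ℂ (Fin n) ≃ₗ[ℂ] EuclideanSpace ℂ (Fin n)}
    (hg : ∀ x y, ⟪g x, g y⟫ = ⟪x, y⟫) (h1 : finrank ℂ (EuclideanSpace ℂ (Fin n) ⧸ fixedSpace g) = 1)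
    {v : EuclideanSpace ℂ (Fin n)} (hv : v ∈ (fixedSpace g)ᗮ) (h0 : v ≠ 0) :
    (fixedSpace g)ᗮ = ℂ ∙ v ∧ ∃ η : ℂ, ‖η‖ = 1 ∧ η ≠ 1 ∧
      ∀ x, x - g x = ((1 - η) * ⟪v, x⟫ / ⟪v, v⟫) • v := by
  have hF : finrank ℂ (fixedSpace g)ᗮ = 1 := by
    have e1 := (fixedSpace g).finrank_add_finrank_orthogonal
    have e2 := (fixedSpace g).finrank_quotient_add_finrank
    omega
  have hspan : (ℂ ∙ v) = (fixedSpace g)ᗮ := by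
    apply Submodule.eq_of_le_of_finrank_eq
    · rwa [Submodule.span_singleton_le_iff_mem]
    · rw [hF, finrank_span_singleton h0]
  have hvv : ⟪v, v⟫ ≠ 0 := inner_self_ne_zero.2 h0
  have hgv : g v ∈ (fixedSpace g)ᗮ := by
    rw [Submodule.mem_orthogonal]
    intro h hh
    rw [← mem_fixedSpace.1 hh, hg]
    exact (Submodule.mem_orthogonal _ _).1 hv h hh
  rw [← hspan, Submodule.mem_span_singleton] at hgv
  obtain ⟨η, hη⟩ := hgv
  have hfix : ∀ x, ⟪v, x⟫ = 0 → g x = x := fun x hx => by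
    have : x ∈ (fixedSpace g)ᗮᗮ := by
      rw [← hspan, Submodule.mem_orthogonal_singleton_iff_inner_right]; exact hx
    rw [Submodule.orthogonal_orthogonal] at this
    exact this
  refine ⟨hspan.symm, η, ?_, ?_, fun x => ?_⟩
  · have h2 : ⟪η • v, η • v⟫ = ⟪v, v⟫ := by rw [hη, hg]
    have h3 : ‖η • v‖ = ‖v‖ := by
      rw [@norm_eq_sqrt_re_inner ℂ, h2, ← @norm_eq_sqrt_re_inner ℂ]
    rw [norm_smul] at h3
    exact mul_right_cancel₀ (norm_ne_zero_iff.2 h0) (h3.trans (one_mul _).symm)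
  · rintro rfl
    have h2 : v ∈ fixedSpace g := by rw [mem_fixedSpace, ← hη, one_smul]
    exact hvv ((Submodule.mem_orthogonal _ _).1 hv v h2)
  · have h2 := hfix (x - (⟪v, x⟫ / ⟪v, v⟫) • v) (by
      rw [inner_sub_right, inner_smul_right]; field_simp; ring)
    rw [map_sub, map_smul, ← hη] at h2
    have h3 : g x = x - (⟪v, x⟫ / ⟪v, v⟫) • v + (⟪v, x⟫ / ⟪v, v⟫) • η • v := by
      rw [← h2]; abel
    rw [h3]
    module

theorem exists_norm_sq_eq_natCast {x : EuclideanSpace ℂ (Fin n)} (hx : ∀ i, x i ∈ eisenstein) :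
    ∃ m : ℕ, ‖x‖ ^ 2 = m := by
  choose f hf using fun i => exists_norm_sq_eq (hx i)
  refine ⟨∑ i, f i, ?_⟩
  rw [EuclideanSpace.norm_sq_eq]
  push_cast
  exact Finset.sum_congr rfl fun i _ => (hf i).1

/-- The normal vectors of the reflections in a group generated by reflections of order two which
preserves a lattice over the Eisenstein integers. -/
theorem exists_normal_of_isReflection {s : ℕ} (hs : 0 < s)
    {R R₀ : Set (EuclideanSpace ℂ (Fin n))}
    (hnorm : ∀ r ∈ R, ⟪r, r⟫ = 2 * s)
    (hR : ∀ r ∈ R, ∀ r' ∈ R, ⟪r, r'⟫ / s ∈ eisenstein)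
    (hint : ∀ x, (∀ r ∈ R, ⟪r, x⟫ / s ∈ eisenstein) → ∀ i, x i ∈ eisenstein)
    (hR₀ : ∀ v ∈ R₀, ∃ c : ℂ, c ≠ 0 ∧ c • v ∈ R)
    {g : EuclideanSpace ℂ (Fin n) ≃ₗ[ℂ] EuclideanSpace ℂ (Fin n)}
    (hgW : g ∈ reflectionGroup R₀) (hg : IsReflection g) :
    ∃ v, v ≠ 0 ∧ fixedSpace g = (ℂ ∙ v)ᗮ ∧ (∀ r ∈ R, ⟪r, v⟫ / s ∈ eisenstein) ∧
      ∃ τ ∈ eisenstein, τ ≠ 0 ∧ ‖τ‖ * ‖v‖ ^ 2 ≤ 2 * s ∧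
        ∃ m : ℤ, ‖τ‖ ^ 2 * ‖v‖ ^ 2 = s * m := by
  have hs' : (s : ℂ) ≠ 0 := by exact_mod_cast hs.ne'
  -- `L` is the dual of `R` for the form `⟪·,·⟫ / s`. By `hR` it contains `R`, so the generating
  -- reflections, and with them the whole group, preserve it.
  set L : Set (EuclideanSpace ℂ (Fin n)) := {x | ∀ r ∈ R, ⟪r, x⟫ / s ∈ eisenstein} with hL
  have Lsub : ∀ x ∈ L, ∀ y ∈ L, x - y ∈ L := fun x hx y hy r hr => by
    rw [inner_sub_right, sub_div]; exact sub_mem (hx r hr) (hy r hr)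
  have Lsmul : ∀ q ∈ eisenstein, ∀ x ∈ L, q • x ∈ L := fun q hq x hx r hr => by
    rw [inner_smul_right, mul_div_assoc]; exact mul_mem hq (hx r hr)
  have key : (∀ x y, ⟪g x, g y⟫ = ⟪x, y⟫) ∧ ∀ x, g x ∈ L ↔ x ∈ L := by
    refine Subgroup.closure_induction (p := fun g _ =>
      (∀ x y, ⟪g x, g y⟫ = ⟪x, y⟫) ∧ ∀ x, g x ∈ L ↔ x ∈ L) ?_ ?_ ?_ ?_ hgW
    · rintro _ ⟨v, hv, -, rfl⟩
      obtain ⟨c, hc, hcv⟩ := hR₀ v hv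
      have e := reflection_orthogonal_singleton_apply hc rfl (hnorm _ hcv)
      have h1 : ∀ x ∈ L, (Submodule.reflection (ℂ ∙ v)ᗮ) x ∈ L := fun x hx => by
        rw [e]
        exact Lsub x hx _ (Lsmul _ (hx _ hcv) _ fun r hr => hR r hr _ hcv)
      refine ⟨fun x y => LinearIsometryEquiv.inner_map_map _ x y, fun x => ⟨fun h => ?_, h1 x⟩⟩
      have := h1 _ h
      simpa using this
    · exact ⟨fun x y => rfl, fun x => Iff.rfl⟩
    · rintro g h - - ⟨g1, g2⟩ ⟨h1, h2⟩
      exact ⟨fun x y => by rw [LinearEquiv.mul_apply, LinearEquiv.mul_apply, g1, h1],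
        fun x => by rw [LinearEquiv.mul_apply, g2, h2]⟩
    · rintro g - ⟨g1, g2⟩
      have e : ∀ x, g (g⁻¹ x) = x := fun x => LinearEquiv.apply_symm_apply g x
      exact ⟨fun x y => by rw [← g1, e, e], fun x => by rw [← g2, e]⟩
  obtain ⟨hiso, hgL⟩ := key
  have hdiff : ∀ x, x - g x ∈ (fixedSpace g)ᗮ := fun x => by
    rw [Submodule.mem_orthogonal]
    intro h hh
    rw [inner_sub_right]
    nth_rewrite 2 [← mem_fixedSpace.1 hh]
    rw [hiso, sub_self]
  have hnat : ∀ x ∈ L, ∃ m : ℕ, ‖x‖ ^ 2 = m := fun x hx => exists_norm_sq_eq_natCast (hint x hx)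
  have hex : ∃ m : ℕ, ∃ v ∈ (fixedSpace g)ᗮ, v ≠ 0 ∧ v ∈ L ∧ ‖v‖ ^ 2 = m := by
    -- If `g` fixed all of `R`, every multiple of a normal vector would lie in `L`, including one
    -- with an entry `1/2`. Otherwise `r - g r` is a nonzero normal vector in `L` for some root `r`.
    by_cases hall : ∀ r ∈ R, r ∈ fixedSpace g
    · exfalso
      have hne : (fixedSpace g)ᗮ ≠ ⊥ := fun h => by
        rw [Submodule.orthogonal_eq_bot_iff] at h
        have := hg.2
        have e2 := (fixedSpace g).finrank_quotient_add_finrank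
        rw [h, finrank_top] at e2
        rw [h] at this
        omega
      obtain ⟨a, ha, ha0⟩ := Submodule.exists_mem_ne_zero_of_ne_bot hne
      obtain ⟨i, hi⟩ : ∃ i, a i ≠ 0 := by
        by_contra! h
        exact ha0 (by ext i; simpa using h i)
      have hh := hint ((1 / (2 * a i)) • a) (fun r hr => by
        rw [inner_smul_right, (Submodule.mem_orthogonal _ _).1 ha r (hall r hr)]
        simp [zero_mem]) i
      have h2 : ((1 / (2 * a i)) • a) i = 1 / 2 := by
        rw [PiLp.smul_apply, smul_eq_mul]; field_simp
      rw [h2] at hh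
      have := one_le_norm_sq hh (by norm_num)
      norm_num at this
    · push Not at hall
      obtain ⟨r, hr, hrF⟩ := hall
      have hrL : r ∈ L := fun r' hr' => hR r' hr' r hr
      have h1 := Lsub r hrL (g r) ((hgL r).2 hrL)
      obtain ⟨m, hm⟩ := hnat _ h1
      exact ⟨m, r - g r, hdiff r, fun h => hrF (sub_eq_zero.1 h).symm, h1, hm⟩
  classical
  obtain ⟨v, hvF, hv0, hvL, hvm⟩ := Nat.find_spec hex
  have hmin : ∀ w ∈ (fixedSpace g)ᗮ, w ∈ L → ‖w‖ < ‖v‖ → w = 0 := fun w hwF hwL hlt => by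
    by_contra hw0
    obtain ⟨m, hm⟩ := hnat w hwL
    have h1 := Nat.find_min' hex ⟨w, hwF, hw0, hwL, hm⟩
    have h2 : ‖v‖ ^ 2 ≤ ‖w‖ ^ 2 := by rw [hvm, hm]; exact_mod_cast h1
    exact absurd (pow_lt_pow_left₀ hlt (norm_nonneg w) two_ne_zero) (not_lt.2 h2)
  obtain ⟨hspan, η, hη1, hη, hx⟩ := exists_sub_apply_eq hiso hg.2 hvF hv0
  -- Division with remainder: by minimality, `v` generates all lattice vectors on its line.
  have hcoef : ∀ t : ℂ, t • v ∈ L → t ∈ eisenstein := fun t ht => by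
    obtain ⟨q, hq, hlt⟩ := exists_near t
    have h1 : (t - q) • v ∈ L := by rw [sub_smul]; exact Lsub _ ht _ (Lsmul q hq v hvL)
    have h2 := hmin _ (Submodule.smul_mem _ (t - q) hvF) h1 (by
      rw [norm_smul]
      have := norm_pos_iff.2 hv0
      nlinarith)
    rcases smul_eq_zero.1 h2 with h | h
    · rwa [sub_eq_zero.1 h]
    · exact absurd h hv0
  have hvv : ⟪v, v⟫ = ((‖v‖ ^ 2 : ℝ) : ℂ) := by
    rw [inner_self_eq_norm_sq_to_K]; push_cast; rfl
  have hvp : 0 < ‖v‖ ^ 2 := by have := norm_pos_iff.2 hv0; positivity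
  have hvc : ((‖v‖ ^ 2 : ℝ) : ℂ) ≠ 0 := by exact_mod_cast hvp.ne'
  have hκ : ∀ x ∈ L, (1 - η) * ⟪v, x⟫ / ⟪v, v⟫ ∈ eisenstein := fun x hxL =>
    hcoef _ (by rw [← hx]; exact Lsub _ hxL _ ((hgL x).2 hxL))
  -- Chosen so that `⟪τ • v, x⟫ / s` is the coefficient of `v` in `x - g x`. Thus `τ • v` pairs
  -- integrally with `L`; as `R ⊆ L`, it lies in `L` itself, which makes `τ` integral.
  set τ : ℂ := s * (1 - conj η) / ((‖v‖ ^ 2 : ℝ) : ℂ) with hτ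
  have hpair : ∀ x ∈ L, ⟪x, τ • v⟫ / s ∈ eisenstein := fun x hxL => by
    have h1 := conj_mem (hκ x hxL)
    convert h1 using 1
    rw [hvv, inner_smul_right, map_div₀, map_mul, inner_conj_symm, Complex.conj_ofReal, hτ, map_sub,
      map_one]
    field_simp
  have hτL : τ • v ∈ L := fun r hr => hpair r fun r' hr' => hR r' hr' r hr
  have hτn : ‖τ‖ * ‖v‖ ^ 2 = s * ‖1 - η‖ := by
    have : ‖1 - conj η‖ = ‖1 - η‖ := by
      rw [← Complex.norm_conj (1 - η)]; simp
    rw [hτ, norm_div, norm_mul, this, Complex.norm_real, Complex.norm_natCast, Real.norm_eq_abs,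
      abs_of_pos hvp]
    field_simp
  refine ⟨v, hv0, ?_, hvL, τ, hcoef τ hτL, ?_, ?_, ?_⟩
  · rw [← hspan, Submodule.orthogonal_orthogonal]
  · refine div_ne_zero (mul_ne_zero hs' fun h => hη ?_) hvc
    have := congrArg conj (sub_eq_zero.1 h)
    simpa using this.symm
  · rw [hτn]
    have h1 : ‖1 - η‖ ≤ 2 := (norm_sub_le _ _).trans (by rw [hη1, norm_one]; norm_num)
    have h2 : (0 : ℝ) ≤ s := by positivity
    nlinarith
  · have h1 := hpair _ hτL
    have h2 : ⟪τ • v, τ • v⟫ / s = ((‖τ • v‖ ^ 2 / s : ℝ) : ℂ) := by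
      rw [inner_self_eq_norm_sq_to_K]; push_cast; rfl
    rw [h2] at h1
    obtain ⟨m, hm⟩ := eq_intCast_of_ofReal_mem h1
    refine ⟨m, ?_⟩
    have hs'' : (s : ℝ) ≠ 0 := by exact_mod_cast hs.ne'
    rw [← hm, norm_smul, mul_pow]
    field_simp

end Lattice

/-! ### Modular elements, conjugation and normal planes -/

section Modular

local notation "⟪" x ", " y "⟫" => inner ℂ x y

theorem reflectionArrangement_conj {V V' : Type*} [AddCommGroup V] [Module ℂ V] [AddCommGroup V']
    [Module ℂ V'] {W : Subgroup (V ≃ₗ[ℂ] V)} {W' : Subgroup (V' ≃ₗ[ℂ] V')} {e : V ≃ₗ[ℂ] V'}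
    (he : ∀ g : V ≃ₗ[ℂ] V, g ∈ W ↔ (e.symm.trans g).trans e ∈ W') :
    reflectionArrangement W' = (Submodule.orderIsoMapComap e) '' reflectionArrangement W := by
  let φ : (V ≃ₗ[ℂ] V) ≃* (V' ≃ₗ[ℂ] V') :=
    { toFun := fun g => (e.symm.trans g).trans e
      invFun := fun g => (e.trans g).trans e.symm
      left_inv := fun g => by ext; simp
      right_inv := fun g => by ext; simp
      map_mul' := fun g h => by ext; simp }
  have hφ : ∀ g x, φ g (e x) = e (g x) := fun g x => by simp [φ]
  have hfix : ∀ g, Submodule.map (e : V →ₗ[ℂ] V') (fixedSpace g) = fixedSpace (φ g) := fun g => by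
    ext y
    obtain ⟨x, rfl⟩ := e.surjective y
    rw [mem_fixedSpace, hφ, e.injective.eq_iff, ← mem_fixedSpace]
    exact ⟨fun ⟨z, hz, h⟩ => e.injective h ▸ hz, fun h => ⟨x, h, rfl⟩⟩
  have hrefl : ∀ g, IsReflection g ↔ IsReflection (φ g) := fun g => by
    rw [IsReflection, IsReflection, ← φ.injective.isOfFinOrder_iff (f := φ.toMonoidHom)]
    rw [(Submodule.Quotient.equiv _ _ e (hfix g)).finrank_eq]
    exact Iff.rfl
  ext H
  constructor
  · rintro ⟨g', hg', hr, rfl⟩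
    obtain ⟨g, rfl⟩ := φ.surjective g'
    exact ⟨fixedSpace g, ⟨g, (he g).2 hg', (hrefl g).2 hr, rfl⟩, hfix g⟩
  · rintro ⟨_, ⟨g, hg, hr, rfl⟩, rfl⟩
    exact ⟨φ g, (he g).1 hg, (hrefl g).1 hr, (hfix g).symm⟩

theorem intersectionLattice_image {V V' : Type*} [AddCommGroup V] [Module ℂ V] [AddCommGroup V']
    [Module ℂ V'] (e : Submodule ℂ V ≃o Submodule ℂ V') (A : Set (Submodule ℂ V)) :
    intersectionLattice (e '' A) = e '' intersectionLattice A := by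
  ext X
  constructor
  · rintro ⟨B, hB, rfl⟩
    obtain ⟨C, hC, rfl⟩ := Set.subset_image_iff.1 hB
    exact ⟨sInf C, ⟨C, hC, rfl⟩, by rw [e.map_sInf, sInf_image]⟩
  · rintro ⟨_, ⟨B, hB, rfl⟩, rfl⟩
    exact ⟨e '' B, Set.image_mono hB, by rw [e.map_sInf, sInf_image]⟩

theorem IsLinearlyConjugate.exists_modular {V V' : Type*} [AddCommGroup V] [Module ℂ V]
    [AddCommGroup V'] [Module ℂ V'] {W : Subgroup (V ≃ₗ[ℂ] V)} {W' : Subgroup (V' ≃ₗ[ℂ] V')}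
    (h : IsLinearlyConjugate W W') {k : ℕ}
    (hX : ∃ X, IsModularElement (reflectionArrangement W) X ∧ rank X = k) :
    ∃ X, IsModularElement (reflectionArrangement W') X ∧ rank X = k := by
  obtain ⟨e, he⟩ := h
  obtain ⟨X, ⟨hXL, hXm⟩, hk⟩ := hX
  refine ⟨Submodule.orderIsoMapComap e X, ⟨?_, ?_⟩, ?_⟩
  · rw [reflectionArrangement_conj he, intersectionLattice_image]
    exact ⟨X, hXL, rfl⟩
  · rw [reflectionArrangement_conj he, intersectionLattice_image]
    rintro _ ⟨Y, hY, rfl⟩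
    exact ⟨X ⊔ Y, hXm Y hY, OrderIso.map_sup _ _ _⟩
  · rw [← hk]
    exact ((Submodule.Quotient.equiv X _ e rfl).finrank_eq).symm

variable {n : ℕ}

/-- The line spanned by `y` is an intersection of members of `A`. -/
def IsVertex (A : Set (Submodule ℂ (EuclideanSpace ℂ (Fin n)))) (y : EuclideanSpace ℂ (Fin n)) :
    Prop :=
  ∀ x, (∀ H ∈ A, y ∈ H → x ∈ H) → ∃ c : ℂ, x = c • y

/-- The only consequence of modularity that is used: `X ⊔ ℂ y` is an intersection of members of `A`,
and the intersection is not empty because adding a line to a subspace of codimension 2 cannot fill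
the space. -/
theorem IsModularElement.exists_mem {A : Set (Submodule ℂ (EuclideanSpace ℂ (Fin n)))}
    {X : Submodule ℂ (EuclideanSpace ℂ (Fin n))} (hX : IsModularElement A X) (hr : rank X = 2)
    {y : EuclideanSpace ℂ (Fin n)} (hy : IsVertex A y) : ∃ H ∈ A, X ≤ H ∧ y ∈ H := by
  have hY : (ℂ ∙ y) ∈ intersectionLattice A := by
    refine ⟨{H | H ∈ A ∧ y ∈ H}, fun H hH => hH.1, le_antisymm ?_ fun x hx => ?_⟩
    · rw [Submodule.span_singleton_le_iff_mem, Submodule.mem_sInf]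
      exact fun H hH => hH.2
    · rw [Submodule.mem_sInf] at hx
      obtain ⟨c, rfl⟩ := hy x fun H hH hyH => hx H ⟨hH, hyH⟩
      exact Submodule.smul_mem _ c (Submodule.mem_span_singleton_self y)
  obtain ⟨B, hB, hXY⟩ := hX.2 _ hY
  have hne : B.Nonempty := by
    rw [Set.nonempty_iff_ne_empty]
    rintro rfl
    rw [sInf_empty] at hXY
    have h1 := Submodule.finrank_add_le_finrank_add_finrank X (ℂ ∙ y)
    have h2 := X.finrank_quotient_add_finrank
    have h3 : finrank ℂ (ℂ ∙ y) ≤ 1 := by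
      simpa using finrank_span_le_card (R := ℂ) ({y} : Set (EuclideanSpace ℂ (Fin n)))
    rw [hXY, finrank_top] at h1
    rw [rank] at hr
    omega
  obtain ⟨H, hH⟩ := hne
  have hle : X ⊔ (ℂ ∙ y) ≤ H := hXY ▸ sInf_le hH
  exact ⟨H, hB hH, le_sup_left.trans hle,
    hle (Submodule.mem_sup_right (Submodule.mem_span_singleton_self y))⟩

theorem finrank_orthogonal_of_rank {X : Submodule ℂ (EuclideanSpace ℂ (Fin n))} {k : ℕ}
    (hr : rank X = k) : finrank ℂ Xᗮ = k := by
  have h1 := X.finrank_quotient_add_finrank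
  have h2 := X.finrank_add_finrank_orthogonal
  rw [rank] at hr
  omega

theorem exists_eq_smul_add_smul {P : Submodule ℂ (EuclideanSpace ℂ (Fin n))}
    (hP : finrank ℂ P = 2) {v w : EuclideanSpace ℂ (Fin n)} (hv : v ∈ P) (hw : w ∈ P)
    (hvw : ∀ s t : ℂ, s • v + t • w = 0 → s = 0 ∧ t = 0) {u : EuclideanSpace ℂ (Fin n)}
    (hu : u ∈ P) : ∃ s t : ℂ, u = s • v + t • w := by
  have hli : LinearIndependent ℂ ![v, w] := LinearIndependent.pair_iff.2 hvw
  have h1 := finrank_span_eq_card hli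
  have h2 : Submodule.span ℂ (Set.range ![v, w]) = P := by
    apply Submodule.eq_of_le_of_finrank_eq
    · rw [Submodule.span_le]
      rintro _ ⟨i, rfl⟩
      fin_cases i
      exacts [hv, hw]
    · rw [h1, hP]; rfl
  rw [← h2, Matrix.range_cons_cons_empty, Submodule.mem_span_pair] at hu
  obtain ⟨s, t, h⟩ := hu
  exact ⟨s, t, h.symm⟩

theorem mem_orthogonal_of_le {X : Submodule ℂ (EuclideanSpace ℂ (Fin n))}
    {v : EuclideanSpace ℂ (Fin n)} (h : X ≤ (ℂ ∙ v)ᗮ) : v ∈ Xᗮ := by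
  rw [Submodule.mem_orthogonal']
  exact fun x hx => Submodule.mem_orthogonal_singleton_iff_inner_right.1 (h hx)

/-- A reflection of order two which belongs to `W` puts its hyperplane into the arrangement. -/
theorem orthogonal_mem_reflectionArrangement {v : EuclideanSpace ℂ (Fin n)} (hv : v ≠ 0)
    {W : Subgroup (EuclideanSpace ℂ (Fin n) ≃ₗ[ℂ] EuclideanSpace ℂ (Fin n))}
    (h : (Submodule.reflection (ℂ ∙ v)ᗮ).toLinearEquiv ∈ W) :
    (ℂ ∙ v)ᗮ ∈ reflectionArrangement W := by
  have hfix : fixedSpace (Submodule.reflection (ℂ ∙ v)ᗮ).toLinearEquiv = (ℂ ∙ v)ᗮ := by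
    ext x
    rw [mem_fixedSpace]
    exact Submodule.reflection_eq_self_iff x
  refine ⟨_, h, ⟨isOfFinOrder_iff_pow_eq_one.2 ⟨2, two_pos, ?_⟩, ?_⟩, hfix⟩
  · ext1 x
    rw [pow_two, LinearEquiv.mul_apply]
    exact Submodule.reflection_reflection _ x
  · rw [hfix]
    have h1 := ((ℂ ∙ v)ᗮ).finrank_quotient_add_finrank
    have h2 := (ℂ ∙ v).finrank_add_finrank_orthogonal
    rw [finrank_span_singleton hv] at h2
    omega

end Modular

/-! ### Monomial groups, and the argument shared with `G₃₄` -/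

section Monomial

open ComplexConjugate

local notation "⟪" x ", " y "⟫" => inner ℂ x y

variable {n : ℕ}

theorem inner_single_sub_single (i j : Fin n) (ζ : ℂ) (x : EuclideanSpace ℂ (Fin n)) :
    ⟪EuclideanSpace.single i (1 : ℂ) - EuclideanSpace.single j ζ, x⟫ = x i - conj ζ * x j := by
  rw [inner_sub_left, EuclideanSpace.inner_single_left, EuclideanSpace.inner_single_left]
  simp

theorem single_sub_single_apply_left {i j : Fin n} (h : i ≠ j) (ζ : ℂ) :
    (EuclideanSpace.single i (1 : ℂ) - EuclideanSpace.single j ζ) i = 1 := by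
  simp [h]

theorem single_sub_single_apply_right {i j : Fin n} (h : i ≠ j) (ζ : ℂ) :
    (EuclideanSpace.single i (1 : ℂ) - EuclideanSpace.single j ζ) j = -ζ := by
  simp [h.symm]

theorem single_sub_single_apply_of_ne {i j k : Fin n} (hi : k ≠ i) (hj : k ≠ j) (ζ : ℂ) :
    (EuclideanSpace.single i (1 : ℂ) - EuclideanSpace.single j ζ) k = 0 := by
  simp [hi, hj]

theorem single_sub_single_ne_zero {i j : Fin n} (h : i ≠ j) (ζ : ℂ) :
    EuclideanSpace.single i (1 : ℂ) - EuclideanSpace.single j ζ ≠ 0 := fun h0 => by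
  have := single_sub_single_apply_left h ζ
  rw [h0] at this
  simp at this

theorem conj_mul_of_pow_eq_one {r : ℕ} (hr : r ≠ 0) {ζ : ℂ} (h : ζ ^ r = 1) : conj ζ * ζ = 1 := by
  rw [mul_comm, Complex.mul_conj', Complex.norm_eq_one_of_pow_eq_one h hr]
  norm_num

theorem conj_pow_eq_one {r : ℕ} {ζ : ℂ} (h : ζ ^ r = 1) : conj ζ ^ r = 1 := by
  rw [← map_pow, h, map_one]

/-- An arrangement which contains the arrangement of `G(r,r,n)` and all of whose other members
have normal vectors without zero entries has no modular element of rank two. -/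
theorem not_exists_modular_of_monomial {r : ℕ} (hr : 3 ≤ r) (hn : 5 ≤ n)
    {A : Set (Submodule ℂ (EuclideanSpace ℂ (Fin n)))}
    (ha : ∀ (i j : Fin n) (ζ : ℂ), i ≠ j → ζ ^ r = 1 →
      (ℂ ∙ (EuclideanSpace.single i (1 : ℂ) - EuclideanSpace.single j ζ))ᗮ ∈ A)
    (hb : ∀ H ∈ A, ∃ v, v ≠ 0 ∧ H = (ℂ ∙ v)ᗮ ∧ ((∃ i, v i = 0) → ∃ (j k : Fin n) (ζ : ℂ),
      j ≠ k ∧ ζ ^ r = 1 ∧ v = EuclideanSpace.single j (1 : ℂ) - EuclideanSpace.single k ζ)) :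
    ¬ ∃ X, IsModularElement A X ∧ rank X = 2 := by
  rintro ⟨X, hX, hrk⟩
  have hr0 : r ≠ 0 := by omega
  have hP := finrank_orthogonal_of_rank hrk
  have hroot : ∀ y, IsVertex A y → ∃ v ∈ Xᗮ, v ≠ 0 ∧ ⟪v, y⟫ = 0 ∧ ((∃ i, v i = 0) →
      ∃ (j k : Fin n) (ζ : ℂ), j ≠ k ∧ ζ ^ r = 1 ∧
        v = EuclideanSpace.single j (1 : ℂ) - EuclideanSpace.single k ζ) := fun y hy => by
    obtain ⟨H, hHA, hXH, hyH⟩ := hX.exists_mem hrk hy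
    obtain ⟨v, hv0, rfl, hv⟩ := hb H hHA
    exact ⟨v, mem_orthogonal_of_le hXH, hv0,
      Submodule.mem_orthogonal_singleton_iff_inner_right.1 hyH, hv⟩
  have hsmall : ∀ (T : Finset (Fin n)), T.card ≤ 4 → ∃ i, i ∉ T := fun T hT => by
    by_contra! h
    have h1 : T = Finset.univ := Finset.eq_univ_iff_forall.2 h
    rw [h1, Finset.card_univ, Fintype.card_fin] at hT
    omega
  have hmem : ∀ {x y : EuclideanSpace ℂ (Fin n)}, (∀ H ∈ A, y ∈ H → x ∈ H) →
      ∀ (i j : Fin n) (ζ : ℂ), i ≠ j → ζ ^ r = 1 → y i - ζ * y j = 0 → x i - ζ * x j = 0 := by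
    intro x y hxy i j ζ hij hζ h
    have := hxy _ (ha i j (conj ζ) hij (conj_pow_eq_one hζ))
    rw [Submodule.mem_orthogonal_singleton_iff_inner_right,
      Submodule.mem_orthogonal_singleton_iff_inner_right, inner_single_sub_single,
      inner_single_sub_single, Complex.conj_conj] at this
    exact this h
  obtain ⟨ζ, hζ⟩ : ∃ ζ : ℂ, IsPrimitiveRoot ζ r := ⟨_, Complex.isPrimitiveRoot_exp r hr0⟩
  have hζr : ζ ^ r = 1 := hζ.pow_eq_one
  have hζ1 : ζ ≠ 1 := hζ.ne_one (by omega)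
  have hζ2 : ζ + 1 ≠ 0 := fun h => hζ.pow_ne_one_of_pos_of_lt two_ne_zero (by omega)
    (by linear_combination (ζ - 1) * h)
  have hvert1 : ∀ i, IsVertex A (EuclideanSpace.single i (1 : ℂ)) := by
    intro i x hx
    refine ⟨x i, ?_⟩
    ext k
    by_cases hk : k = i
    · subst hk; simp
    -- With a third index `j`, the hyperplanes `x j = x k` and `x j = ζ * x k` both contain `e_i`
    -- and together force `x k = 0`.
    obtain ⟨j, hj⟩ := hsmall {i, k} (Finset.card_le_two.trans (by norm_num))
    simp only [Finset.mem_insert, Finset.mem_singleton, not_or] at hj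
    have h1 := hmem hx j k 1 hj.2 (one_pow r) (by simp [hj.1, hk])
    have h2 := hmem hx j k ζ hj.2 hζr (by simp [hj.1, hk])
    have h3 : (ζ - 1) * x k = 0 := by linear_combination h1 - h2
    rcases mul_eq_zero.1 h3 with h | h
    · exact absurd (sub_eq_zero.1 h) hζ1
    · simp [hk, h]
  have hvert2 : ∀ f : Fin n → ℂ, (∀ i, f i ^ r = 1) → IsVertex A (WithLp.toLp 2 f) := by
    intro f hf x hx
    have hf0 : ∀ i, f i ≠ 0 := fun i h => by
      have := hf i
      rw [h, zero_pow hr0] at this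
      exact zero_ne_one this
    obtain ⟨i, -⟩ := hsmall ∅ (by simp)
    refine ⟨x i / f i, ?_⟩
    ext k
    by_cases hk : k = i
    · subst hk; simp [hf0]
    · have := hmem hx k i (f k / f i) hk (by rw [div_pow, hf, hf, div_one]) (by
        have := hf0 i
        simp only
        field_simp
        ring)
      simp only [PiLp.smul_apply, smul_eq_mul]
      linear_combination this
  have hne : ∀ {z : ℂ}, z ^ r = 1 → z ≠ 0 := fun h h0 => by
    rw [h0, zero_pow hr0] at h
    exact zero_ne_one h
  -- three nonzero entries, and a zero entry, exclude a vector from being a normal vector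
  have hthree : ∀ u : EuclideanSpace ℂ (Fin n), ((∃ i, u i = 0) →
      ∃ (j k : Fin n) (ζ : ℂ), j ≠ k ∧ ζ ^ r = 1 ∧
        u = EuclideanSpace.single j (1 : ℂ) - EuclideanSpace.single k ζ) →
      (∃ i, u i = 0) → ∀ a b c, a ≠ b → a ≠ c → b ≠ c → u a ≠ 0 → u b ≠ 0 → u c ≠ 0 → False := by
    intro u hu h0 a b c hab hac hbc h1 h2 h3
    obtain ⟨j, k, ξ, -, -, rfl⟩ := hu h0
    have : ∀ i, (EuclideanSpace.single j (1 : ℂ) - EuclideanSpace.single k ξ) i ≠ 0 →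
        i = j ∨ i = k := fun i hi => by
      by_contra! h
      exact hi (single_sub_single_apply_of_ne h.1 h.2 ξ)
    rcases this a h1 with rfl | rfl <;> rcases this b h2 with rfl | rfl <;>
      rcases this c h3 with rfl | rfl <;> simp_all
  have chain : ∀ (a b d : Fin n) (θ θ' : ℂ), a ≠ b → a ≠ d → b ≠ d → θ ^ r = 1 → θ' ^ r = 1 →
      EuclideanSpace.single a (1 : ℂ) - EuclideanSpace.single b θ ∈ Xᗮ →
      EuclideanSpace.single b (1 : ℂ) - EuclideanSpace.single d θ' ∈ Xᗮ → False := by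
    intro a b d θ θ' hab had hbd hθ hθ' h1 h2
    have hθ0 := hne hθ
    have hθ'0 := hne hθ'
    -- After the phases `θ, θ'` are removed, the entries at `a, b, d` are `ζ², ζ, 1`. Neither given
    -- normal is orthogonal to this vector, so `u` involves both.
    obtain ⟨u, huP, hu0, huy, hu⟩ := hroot _ (hvert2 (fun i => if i = a then
      ζ ^ 2 * conj θ * conj θ' else if i = b then ζ * conj θ' else 1) (fun i => by
        split_ifs
        · rw [mul_pow, mul_pow, conj_pow_eq_one hθ, conj_pow_eq_one hθ', ← pow_mul, mul_comm 2,
            pow_mul, hζr]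
          simp
        · rw [mul_pow, conj_pow_eq_one hθ', hζr, one_mul]
        · exact one_pow r))
    obtain ⟨s, t, rfl⟩ := exists_eq_smul_add_smul hP h1 h2 (fun s t h => by
      have e1 := congrArg (fun v : EuclideanSpace ℂ (Fin n) => v a) h
      have e2 := congrArg (fun v : EuclideanSpace ℂ (Fin n) => v d) h
      simp [hab, had, had.symm, hbd.symm, hθ'0] at e1 e2
      exact ⟨e1, e2⟩) huP
    rw [inner_add_left, inner_smul_left, inner_smul_left, inner_single_sub_single,
      inner_single_sub_single] at huy
    simp only [if_true, if_neg hab.symm, if_neg had.symm, if_neg hbd.symm] at huy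
    have hθ'c : conj θ' ≠ 0 := by simpa using hθ'0
    have h3 : conj θ' * (ζ - 1) * (conj s * ζ * conj θ + conj t) = 0 := by
      linear_combination huy
    have h4 : conj s * ζ * conj θ + conj t = 0 := by
      simpa [hθ'c, sub_ne_zero.2 hζ1] using h3
    have h5 : t = -(s * conj ζ * θ) := by
      have := congrArg conj h4
      simp at this
      linear_combination this
    have hs0 : s ≠ 0 := fun h => by
      rw [h] at h5
      apply hu0
      simp [h, h5]
    have hζ0 := hne hζr
    have ht0 : t ≠ 0 := by rw [h5]; simp [hs0, hζ0, hθ0]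
    obtain ⟨i, hi⟩ := hsmall {a, b, d} (Finset.card_le_three.trans (by norm_num))
    simp only [Finset.mem_insert, Finset.mem_singleton, not_or] at hi
    refine hthree _ hu ⟨i, by simp [hi]⟩ a b d hab had hbd ?_ ?_ ?_
    · simp [hab, had, hs0]
    -- The entry at `b` is `-s * θ * conj (ζ + 1)`; it is nonzero because `r ≥ 3` gives `ζ ≠ -1`.
    · simp [hab.symm, hbd]
      intro h
      rw [h5] at h
      have h6 : s * θ * conj (ζ + 1) = 0 := by
        rw [map_add, map_one]; linear_combination -h
      simp only [mul_eq_zero, hs0, hθ0, false_or] at h6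
      exact hζ2 (by simpa using congrArg conj h6)
    · simp [had.symm, hbd.symm, hθ'0, ht0]
  obtain ⟨i, -⟩ := hsmall ∅ (by simp)
  obtain ⟨v, hvP, -, hvi, hv⟩ := hroot _ (hvert1 i)
  obtain ⟨a, b, θ, hab, hθ, rfl⟩ := hv ⟨i, by
    rw [EuclideanSpace.inner_single_right] at hvi; simpa using hvi⟩
  -- Vanishing at `a`, where the first normal does not, makes `w` independent of it.
  obtain ⟨w, hwP, -, hwa, hw⟩ := hroot _ (hvert1 a)
  have hwa' : w a = 0 := by
    rw [EuclideanSpace.inner_single_right] at hwa; simpa using hwa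
  obtain ⟨c, d, θ', hcd, hθ', rfl⟩ := hw ⟨a, hwa'⟩
  have hθ0 := hne hθ
  have hθ'0 := hne hθ'
  have hac : a ≠ c := by
    rintro rfl
    rw [single_sub_single_apply_left hcd] at hwa'
    exact one_ne_zero hwa'
  have had : a ≠ d := by
    rintro rfl
    rw [single_sub_single_apply_right hcd] at hwa'
    exact hθ'0 (neg_eq_zero.1 hwa')
  by_cases hbc : b = c
  · subst hbc
    exact chain a b d θ θ' hab had hcd hθ hθ' hvP hwP
  by_cases hbd : b = d
  · subst hbd
    refine chain a b c θ θ'⁻¹ hab hac hcd.symm hθ (by rw [inv_pow, hθ', inv_one]) hvP ?_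
    have h1 := Submodule.smul_mem _ (-θ'⁻¹) hwP
    convert h1 using 1
    ext k
    by_cases h1 : k = b
    · subst h1; simp [hcd.symm, hθ'0]
    · by_cases h2 : k = c
      · subst h2; simp [hcd]
      · simp [h1, h2]
  -- The two supports are now disjoint. The twist by `ζ` at `a` and `c` makes both normals
  -- non-orthogonal to this vector, so `u` has four nonzero entries.
  obtain ⟨u, huP, hu0, huy, hu⟩ := hroot _ (hvert2 (fun i => if i = a then
    ζ * conj θ else if i = c then ζ * conj θ' else 1) (fun i => by
      split_ifs
      · rw [mul_pow, conj_pow_eq_one hθ, hζr, one_mul]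
      · rw [mul_pow, conj_pow_eq_one hθ', hζr, one_mul]
      · exact one_pow r))
  obtain ⟨s, t, rfl⟩ := exists_eq_smul_add_smul hP hvP hwP (fun s t h => by
    have e1 := congrArg (fun v : EuclideanSpace ℂ (Fin n) => v a) h
    have e2 := congrArg (fun v : EuclideanSpace ℂ (Fin n) => v c) h
    simp [hab, hac, had, hac.symm, hcd, Ne.symm hbc] at e1 e2
    exact ⟨e1, e2⟩) huP
  rw [inner_add_left, inner_smul_left, inner_smul_left, inner_single_sub_single,
    inner_single_sub_single] at huy
  simp only [if_true, if_neg hab.symm, if_neg had.symm, if_neg hbc, if_neg hcd.symm,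
    if_neg hac.symm] at huy
  have h3 : (ζ - 1) * (conj s * conj θ + conj t * conj θ') = 0 := by
    linear_combination huy
  have h4 : s * θ + t * θ' = 0 := by
    rcases mul_eq_zero.1 h3 with h | h
    · exact absurd (sub_eq_zero.1 h) hζ1
    · simpa using congrArg conj h
  have hs0 : s ≠ 0 := by
    rintro rfl
    have : t = 0 := by simpa [hθ'0] using h4
    exact hu0 (by simp [this])
  have ht0 : t ≠ 0 := by
    rintro rfl
    have : s = 0 := by simpa [hθ0] using h4
    exact hs0 this
  obtain ⟨i, hi⟩ := hsmall {a, b, c, d} Finset.card_le_four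
  simp only [Finset.mem_insert, Finset.mem_singleton, not_or] at hi
  refine hthree _ hu ⟨i, by simp [hi]⟩ a b c hab hac hbc ?_ ?_ ?_
  · simp [hab, hac, had, hs0]
  · simp [hab.symm, hbc, hbd, hs0, hθ0]
  · simp [hac.symm, hcd, Ne.symm hbc, ht0]

theorem eq_orthogonal_of_le {F : Submodule ℂ (EuclideanSpace ℂ (Fin n))}
    (hF : finrank ℂ (EuclideanSpace ℂ (Fin n) ⧸ F) = 1) {v : EuclideanSpace ℂ (Fin n)} (hv : v ≠ 0)
    (h : F ≤ (ℂ ∙ v)ᗮ) : F = (ℂ ∙ v)ᗮ := by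
  apply Submodule.eq_of_le_of_finrank_eq h
  have h1 := F.finrank_quotient_add_finrank
  have h2 := (ℂ ∙ v).finrank_add_finrank_orthogonal
  rw [finrank_span_singleton hv] at h2
  omega

/-- If the permutation moves `i`, fixed vectors satisfy `x i = θ i * x (σ i)`, which already cuts
out a hyperplane. A nontrivial diagonal element of determinant 1 has at least two entries different
from 1 and so fixes too little. -/
theorem exists_normal_of_mem_monomialGroup {r : ℕ}
    {g : EuclideanSpace ℂ (Fin n) ≃ₗ[ℂ] EuclideanSpace ℂ (Fin n)} (hg : g ∈ monomialGroup r n)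
    (hgr : IsReflection g) : ∃ (j k : Fin n) (ζ : ℂ), j ≠ k ∧ ζ ^ r = 1 ∧
      fixedSpace g = (ℂ ∙ (EuclideanSpace.single j (1 : ℂ) - EuclideanSpace.single k ζ))ᗮ := by
  obtain ⟨σ, θ, h1, h2, h3⟩ := hg
  by_cases hσ : ∃ i, σ i ≠ i
  · obtain ⟨i, hi⟩ := hσ
    refine ⟨i, σ i, conj (θ i), hi.symm, conj_pow_eq_one (h1 i), ?_⟩
    refine eq_orthogonal_of_le hgr.2 (single_sub_single_ne_zero hi.symm _) fun x hx => ?_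
    rw [Submodule.mem_orthogonal_singleton_iff_inner_right, inner_single_sub_single,
      Complex.conj_conj, ← h3, mem_fixedSpace.1 hx, sub_self]
  · push Not at hσ
    exfalso
    simp only [hσ] at h3
    obtain ⟨i, hi⟩ : ∃ i, θ i ≠ 1 := by
      by_contra! h
      have : fixedSpace g = ⊤ := by
        rw [Submodule.eq_top_iff']
        intro x
        rw [mem_fixedSpace]
        ext i
        rw [h3, h, one_mul]
      have h4 := (fixedSpace g).finrank_quotient_add_finrank
      rw [hgr.2, this, finrank_top] at h4
      omega
    obtain ⟨j, hji, hj⟩ : ∃ j, j ≠ i ∧ θ j ≠ 1 := by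
      by_contra! h
      rw [Finset.prod_eq_single i (fun j _ hj => h j hj) (by simp)] at h2
      exact hi h2
    have h4 := eq_orthogonal_of_le hgr.2 (v := EuclideanSpace.single i (1 : ℂ)) (by simp)
      fun x hx => by
        rw [Submodule.mem_orthogonal_singleton_iff_inner_right, EuclideanSpace.inner_single_left]
        have h5 := h3 x i
        rw [mem_fixedSpace.1 hx] at h5
        have h6 : (θ i - 1) * x i = 0 := by linear_combination -h5
        simpa [sub_ne_zero.2 hi] using h6
    have h5 : EuclideanSpace.single j (1 : ℂ) ∈ fixedSpace g := by
      rw [h4, Submodule.mem_orthogonal_singleton_iff_inner_right, EuclideanSpace.inner_single_left]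
      simp [hji.symm]
    have h6 := h3 (EuclideanSpace.single j (1 : ℂ)) j
    rw [mem_fixedSpace.1 h5] at h6
    simp at h6
    exact hj h6.symm

theorem reflection_mem_monomialGroup {r : ℕ} (hr : r ≠ 0) {i j : Fin n} (hij : i ≠ j) {ζ : ℂ}
    (hζ : ζ ^ r = 1) :
    (Submodule.reflection (ℂ ∙ (EuclideanSpace.single i (1 : ℂ) -
      EuclideanSpace.single j ζ))ᗮ).toLinearEquiv ∈ monomialGroup r n := by
  have hc := conj_mul_of_pow_eq_one hr hζ
  refine ⟨Equiv.swap i j, fun k => if k = i then conj ζ else if k = j then ζ else 1, fun k => ?_,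
    ?_, fun x k => ?_⟩
  · dsimp only
    split_ifs
    exacts [conj_pow_eq_one hζ, hζ, one_pow r]
  · rw [Finset.prod_eq_mul i j hij (fun k _ hk => by simp [hk]) (by simp) (by simp)]
    simp [hij.symm, hc]
  · have h := reflection_orthogonal_singleton_apply (s := 1) (c := 1) one_ne_zero
      (one_smul ℂ (EuclideanSpace.single i (1 : ℂ) - EuclideanSpace.single j ζ)).symm (by
        rw [inner_single_sub_single, single_sub_single_apply_left hij,
          single_sub_single_apply_right hij]
        push_cast
        linear_combination hc) x
    rw [inner_single_sub_single] at h
    change (Submodule.reflection (ℂ ∙ (EuclideanSpace.single i (1 : ℂ) -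
      EuclideanSpace.single j ζ))ᗮ) x k = _
    rw [h]
    by_cases hki : k = i
    · subst hki
      simp [hij]
    · by_cases hkj : k = j
      · subst hkj
        simp [hij.symm]
        linear_combination -x k * hc
      · simp [hki, hkj, Equiv.swap_apply_of_ne_of_ne]

theorem not_exists_modular_monomialGroup {r : ℕ} (hr : 3 ≤ r) (hn : 5 ≤ n) :
    ¬ ∃ X, IsModularElement (reflectionArrangement (monomialGroup r n)) X ∧ rank X = 2 := by
  refine not_exists_modular_of_monomial hr hn (fun i j ζ hij hζ =>
    orthogonal_mem_reflectionArrangement (single_sub_single_ne_zero hij ζ)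
      (reflection_mem_monomialGroup (by omega) hij hζ)) ?_
  rintro _ ⟨g, hg, hgr, rfl⟩
  obtain ⟨j, k, ζ, hjk, hζ, h⟩ := exists_normal_of_mem_monomialGroup hg hgr
  exact ⟨_, single_sub_single_ne_zero hjk ζ, h, fun _ => ⟨j, k, ζ, hjk, hζ, rfl⟩⟩

end Monomial

/-! ### The group `G₃₄` -/

section K6

open ComplexConjugate

local notation "⟪" x ", " y "⟫" => inner ℂ x y

/-- The line system `K₆`, spanned by vectors which all have norm `6`. -/
def scaledRootsK6 : Set (EuclideanSpace ℂ (Fin 6)) :=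
  {v | ∃ (i j : Fin 6) (ζ : ℂ), i ≠ j ∧ ζ ^ 3 = 1 ∧
    v = (1 - ω) • (EuclideanSpace.single i 1 - EuclideanSpace.single j ζ)} ∪
  {v | (∀ i, v i ^ 3 = 1) ∧ ∏ i, v i = 1}

theorem inner_eq_sum {n : ℕ} (x y : EuclideanSpace ℂ (Fin n)) :
    ⟪x, y⟫ = ∑ i, conj (x i) * y i := by
  rw [PiLp.inner_apply]
  exact Finset.sum_congr rfl fun i _ => by rw [RCLike.inner_apply, mul_comm]

theorem inner_smul_single_sub_single_div (i j : Fin 6) (ζ : ℂ) (x : EuclideanSpace ℂ (Fin 6)) :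
    ⟪(1 - ω) • (EuclideanSpace.single i (1 : ℂ) - EuclideanSpace.single j ζ), x⟫ / (3 : ℕ) =
      (x i - conj ζ * x j) / (1 - ω) := by
  rw [inner_smul_left, inner_single_sub_single]
  have h := one_sub_omega_ne_zero
  have h2 := conj_one_sub_omega_mul
  push_cast
  field_simp
  linear_combination (x i - conj ζ * x j) * h2

theorem inner_self_scaledRootsK6 : ∀ r ∈ scaledRootsK6, ⟪r, r⟫ = 2 * (3 : ℕ) := by
  rintro r (⟨i, j, ζ, hij, hζ, rfl⟩ | ⟨h3, -⟩)
  · rw [inner_smul_left, inner_smul_right, inner_single_sub_single,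
      single_sub_single_apply_left hij, single_sub_single_apply_right hij]
    push_cast
    linear_combination 2 * conj_one_sub_omega_mul +
      conj (1 - ω) * (1 - ω) * conj_mul_of_pow_eq_one three_ne_zero hζ
  · rw [inner_eq_sum, Finset.sum_congr rfl fun i _ => conj_mul_of_pow_eq_one three_ne_zero (h3 i)]
    norm_num

/-- The delicate case pairs two vectors of cube roots of unity: their inner product is a sum of six
cube roots with product 1, hence congruent to 6 modulo 3. -/
theorem inner_scaledRootsK6_div_mem :
    ∀ r ∈ scaledRootsK6, ∀ r' ∈ scaledRootsK6, ⟪r, r'⟫ / (3 : ℕ) ∈ eisenstein := by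
  have h12 : ∀ (i j : Fin 6) (ζ : ℂ), ζ ^ 3 = 1 → ∀ x : EuclideanSpace ℂ (Fin 6),
      (∀ i, x i ^ 3 = 1) → (x i - conj ζ * x j) / (1 - ω) ∈ eisenstein := by
    intro i j ζ hζ x hx
    have h1 := cube_root_sub_one_div_mem (hx i)
    have h2 := cube_root_sub_one_div_mem (z := conj ζ * x j) (by
      rw [mul_pow, conj_pow_eq_one hζ, hx, one_mul])
    convert sub_mem h1 h2 using 1
    ring
  rintro r (⟨i, j, ζ, hij, hζ, rfl⟩ | ⟨h3, hp⟩) r' (⟨i', j', ζ', hij', hζ', rfl⟩ | ⟨h3', hp'⟩)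
  · rw [inner_smul_single_sub_single_div]
    have hO : ∀ k, (EuclideanSpace.single i' (1 : ℂ) - EuclideanSpace.single j' ζ') k ∈
        eisenstein := fun k => by
      by_cases h1 : k = i'
      · rw [h1, single_sub_single_apply_left hij']; exact one_mem _
      · by_cases h2 : k = j'
        · rw [h2, single_sub_single_apply_right hij']; exact neg_mem (cube_root_mem hζ')
        · rw [single_sub_single_apply_of_ne h1 h2]; exact zero_mem _
    convert sub_mem (hO i) (mul_mem (conj_mem (cube_root_mem hζ)) (hO j)) using 1
    rw [PiLp.smul_apply, PiLp.smul_apply, smul_eq_mul, smul_eq_mul]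
    have h := one_sub_omega_ne_zero
    field_simp
  · rw [inner_smul_single_sub_single_div]
    exact h12 i j ζ hζ r' h3'
  · have h := conj_mem (h12 i' j' ζ' hζ' r h3)
    rw [← inner_smul_single_sub_single_div, map_div₀, inner_conj_symm, map_natCast] at h
    exact h
  · rw [inner_eq_sum]
    have h := sum_cube_roots_div_mem Finset.univ (fun i => conj (r i) * r' i) (fun i => by
      rw [mul_pow, conj_pow_eq_one (h3 i), h3', one_mul])
    rw [Finset.prod_mul_distrib, ← map_prod, hp, hp'] at h
    convert sub_mem (natCast_mem eisenstein 2) h using 1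
    rw [Finset.sum_sub_distrib]
    simp
    ring

/-- The difference of the pairings with the roots along `e_j - e_k` and `e_j - ω e_k` is a unit
times `x k`. -/
theorem apply_mem_of_scaledRootsK6 (x : EuclideanSpace ℂ (Fin 6))
    (hx : ∀ r ∈ scaledRootsK6, ⟪r, x⟫ / (3 : ℕ) ∈ eisenstein) (k : Fin 6) : x k ∈ eisenstein := by
  obtain ⟨j, hj⟩ := exists_ne k
  have h1 := hx _ (Or.inl ⟨j, k, 1, hj, by norm_num, rfl⟩)
  have h2 := hx _ (Or.inl ⟨j, k, ω, hj, isPrimitiveRoot_omega.pow_eq_one, rfl⟩)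
  rw [inner_smul_single_sub_single_div] at h1 h2
  convert mul_mem omega_mem (sub_mem h1 h2) using 1
  rw [conj_omega, map_one]
  have h := one_sub_omega_ne_zero
  field_simp
  linear_combination x k * omega_sq

/-- The short vectors with a zero entry in the lattice dual to `K₆`. -/
theorem exists_eq_smul_single_sub_single {v : EuclideanSpace ℂ (Fin 6)} (hv0 : v ≠ 0)
    (hv : ∀ r ∈ scaledRootsK6, ⟪r, v⟫ / (3 : ℕ) ∈ eisenstein) (hn : ‖v‖ ^ 2 ≤ 6)
    {i : Fin 6} (hi : v i = 0) : ∃ (j k : Fin 6) (ζ c : ℂ), j ≠ k ∧ ζ ^ 3 = 1 ∧ c ≠ 0 ∧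
      v = c • (EuclideanSpace.single j (1 : ℂ) - EuclideanSpace.single k ζ) := by
  -- Pairing with the root along `e_k - e_i` exploits the zero at `i`. Nonzero entries then have
  -- squared norm at least 3, so the bound 6 leaves room for only two.
  have hdiv : ∀ k, v k / (1 - ω) ∈ eisenstein := fun k => by
    by_cases hk : k = i
    · rw [hk, hi, zero_div]; exact zero_mem _
    · have := hv _ (Or.inl ⟨k, i, 1, hk, by norm_num, rfl⟩)
      rwa [inner_smul_single_sub_single_div, hi, mul_zero, sub_zero] at this
  have hthree : ∀ k, v k ≠ 0 → 3 ≤ ‖v k‖ ^ 2 := fun k hk => by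
    have := one_le_norm_sq (hdiv k) (div_ne_zero hk one_sub_omega_ne_zero)
    rw [norm_div, div_pow, norm_one_sub_omega_sq] at this
    linarith
  have hsum : (∑ k, v k) / 3 ∈ eisenstein := by
    have := hv (WithLp.toLp 2 fun _ => 1) (Or.inr ⟨fun i => one_pow 3, by simp⟩)
    rw [inner_eq_sum] at this
    simpa using this
  have hsub : ∀ T : Finset (Fin 6), ∑ k ∈ T, ‖v k‖ ^ 2 ≤ 6 := fun T => by
    rw [EuclideanSpace.norm_sq_eq] at hn
    exact (Finset.sum_le_sum_of_subset_of_nonneg (Finset.subset_univ T)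
      fun _ _ _ => by positivity).trans hn
  obtain ⟨j, hj⟩ : ∃ j, v j ≠ 0 := by
    by_contra! h
    exact hv0 (by ext k; simpa using h k)
  -- The all-ones root makes the sum of the entries divisible by 3; a single nonzero entry would
  -- have squared norm at least 9.
  obtain ⟨k, hjk, hk⟩ : ∃ k, j ≠ k ∧ v k ≠ 0 := by
    by_contra! h
    rw [Finset.sum_eq_single j (fun k _ hk => h k hk.symm) (by simp)] at hsum
    have h1 := one_le_norm_sq hsum (div_ne_zero hj three_ne_zero)
    rw [norm_div, div_pow] at h1
    have h2 := hsub {j}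
    rw [Finset.sum_singleton] at h2
    norm_num at h1
    linarith
  have hother : ∀ l, l ≠ j → l ≠ k → v l = 0 := fun l hlj hlk => by
    by_contra hl
    have h1 := hsub {l, j, k}
    rw [Finset.sum_insert (by simp [hlj, hlk]), Finset.sum_pair hjk] at h1
    linarith [hthree l hl, hthree j hj, hthree k hk]
  have h1 := hsub {j, k}
  rw [Finset.sum_pair hjk] at h1
  have hj3 : ‖v j‖ ^ 2 = 3 := by linarith [hthree j hj, hthree k hk]
  have hk3 : ‖v k‖ ^ 2 = 3 := by linarith [hthree j hj, hthree k hk]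
  rw [Finset.sum_eq_add j k hjk (fun l _ hl => hother l hl.1 hl.2) (by simp) (by simp)] at hsum
  obtain ⟨m, hm, -⟩ := exists_norm_sq_eq hsum
  refine ⟨j, k, -v k / v j, v j, hjk, ?_, hj, ?_⟩
  · set u := -v k / v j with hu
    have hun : ‖u‖ ^ 2 = 1 := by
      rw [hu, norm_div, norm_neg, div_pow, hj3, hk3]; norm_num
    have huu : u * conj u = 1 := by
      rw [Complex.mul_conj', ← Complex.ofReal_pow, hun, Complex.ofReal_one]
    have h2 : ‖1 - u‖ ^ 2 = 3 * m := by
      have : 1 - u = (v j + v k) / 3 * (3 / v j) := by rw [hu]; field_simp; ring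
      rw [this, norm_mul, mul_pow, hm, norm_div, div_pow, hj3]
      norm_num
      ring
    have h3 : (1 - u) * (1 - conj u) = 3 * m := by
      have := Complex.mul_conj' (1 - u)
      rw [← Complex.ofReal_pow, h2] at this
      simpa using this
    have h4 : ‖1 - u‖ ≤ 2 := by
      refine (norm_sub_le _ _).trans ?_
      rw [norm_one]
      nlinarith [norm_nonneg u]
    have h5 : m ≤ 1 := by
      have : (3 * m : ℝ) ≤ 4 := by rw [← h2]; nlinarith [norm_nonneg (1 - u)]
      by_contra! h
      have : (2 : ℝ) ≤ m := by exact_mod_cast h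
      linarith
    -- Here `‖1 - u‖² = 3m` with `‖u‖ = 1`: `m = 0` gives `u = 1`, and `m = 1` gives `u² + u + 1 =
    -- 0`.
    interval_cases m
    · have : 1 - u = 0 := by simpa using h2
      rw [← sub_eq_zero.1 this]; norm_num
    · push_cast at h3
      linear_combination (u - 1) * u * (-h3 + huu) - (u - 1) * huu
  · ext l
    by_cases h1 : l = j
    · subst h1; simp [hjk]
    · by_cases h2 : l = k
      · subst h2
        simp [hjk.symm]
        field_simp
      · simp [h1, h2, hother l h1 h2]

theorem not_exists_modular_G34 :
    ¬ ∃ X, IsModularElement (reflectionArrangement G34) X ∧ rank X = 2 := by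
  refine not_exists_modular_of_monomial (r := 3) le_rfl (by norm_num) (fun i j ζ hij hζ =>
    orthogonal_mem_reflectionArrangement (single_sub_single_ne_zero hij ζ)
      (Subgroup.subset_closure ⟨_, Or.inl ⟨i, j, ζ, hij, hζ, rfl⟩,
        single_sub_single_ne_zero hij ζ, rfl⟩)) ?_
  rintro _ ⟨g, hg, hgr, rfl⟩
  obtain ⟨v, hv0, hgv, hv, τ, hτ, hτ0, hle, -⟩ :=
    exists_normal_of_isReflection (R := scaledRootsK6) three_pos inner_self_scaledRootsK6
      inner_scaledRootsK6_div_mem apply_mem_of_scaledRootsK6 (by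
        rintro v (⟨i, j, ζ, hij, hζ, rfl⟩ | h)
        · exact ⟨1 - ω, one_sub_omega_ne_zero, Or.inl ⟨i, j, ζ, hij, hζ, rfl⟩⟩
        · exact ⟨1, one_ne_zero, by rw [one_smul]; exact Or.inr h⟩) hg hgr
  by_cases hz : ∃ i, v i = 0
  · obtain ⟨i, hi⟩ := hz
    have h1 : 1 ≤ ‖τ‖ := by
      have := one_le_norm_sq hτ hτ0
      nlinarith [norm_nonneg τ]
    obtain ⟨j, k, ζ, c, hjk, hζ, hc, rfl⟩ := exists_eq_smul_single_sub_single hv0 hv (by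
      push_cast at hle
      nlinarith [sq_nonneg ‖v‖]) hi
    refine ⟨_, single_sub_single_ne_zero hjk ζ, ?_, fun _ => ⟨j, k, ζ, hjk, hζ, rfl⟩⟩
    rw [hgv, Submodule.span_singleton_smul_eq (IsUnit.mk0 c hc)]
  · exact ⟨v, hv0, hgv, fun h => absurd h hz⟩

end K6

/-! ### The group `G₃₃` -/

section K5

open ComplexConjugate

local notation "⟪" x ", " y "⟫" => inner ℂ x y

/-- The entries of the generalized weighing matrix which defines the line system `K₅`. -/
def weighing (k i : Fin 5) : ℂ := if i = k then 0 else ω ^ phase k i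

theorem weighing_mem (k i : Fin 5) : weighing k i ∈ eisenstein := by
  rw [weighing]
  split_ifs
  exacts [zero_mem _, pow_mem omega_mem _]

theorem weighing_ne_zero {k i : Fin 5} (h : i ≠ k) : weighing k i ≠ 0 := by
  rw [weighing, if_neg h]
  exact pow_ne_zero _ omega_ne_zero

theorem sum_conj_weighing_mul (k l : Fin 5) :
    ∑ i, conj (weighing k i) * weighing l i = if k = l then 4 else 0 := by
  have h := omega_sq
  fin_cases k <;> fin_cases l <;>
    simp [Fin.sum_univ_five, weighing, phase, conj_omega, h] <;>
    first
    | ring1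
    | linear_combination h
    | linear_combination -h
    | linear_combination -2 * h
    | linear_combination 2 * h

/-- The line system `K₅`, spanned by vectors which all have norm `4`. -/
def scaledRootsK5 : Set (EuclideanSpace ℂ (Fin 5)) :=
  {v | ∃ k, v = (2 : ℂ) • EuclideanSpace.single k (1 : ℂ)} ∪
  {v | ∃ (k : Fin 5) (ε : Fin 5 → ℤˣ), ∀ i, v i = ((ε i : ℤ) : ℂ) * weighing k i}

theorem inner_two_smul_single_div (k : Fin 5) (x : EuclideanSpace ℂ (Fin 5)) :
    ⟪(2 : ℂ) • EuclideanSpace.single k (1 : ℂ), x⟫ / (2 : ℕ) = x k := by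
  rw [inner_smul_left, EuclideanSpace.inner_single_left, Complex.conj_ofNat]
  simp

theorem apply_mem_of_mem_scaledRootsK5 {r : EuclideanSpace ℂ (Fin 5)} (hr : r ∈ scaledRootsK5)
    (i : Fin 5) : r i ∈ eisenstein := by
  rcases hr with ⟨k, rfl⟩ | ⟨k, ε, h⟩
  · by_cases hik : i = k
    · simp [hik, ofNat_mem]
    · simp [hik, zero_mem]
  · rw [h]
    exact mul_mem (intCast_mem _ _) (weighing_mem k i)

theorem inner_self_scaledRootsK5 : ∀ r ∈ scaledRootsK5, ⟪r, r⟫ = 2 * (2 : ℕ) := by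
  rintro r (⟨k, rfl⟩ | ⟨k, ε, h⟩)
  · have := inner_two_smul_single_div k ((2 : ℂ) • EuclideanSpace.single k (1 : ℂ))
    rw [div_eq_iff (by norm_num)] at this
    rw [this]
    simp
  · have h4 := sum_conj_weighing_mul k k
    rw [if_pos rfl] at h4
    rw [inner_eq_sum, Finset.sum_congr rfl fun i _ => show
      conj (r i) * r i = conj (weighing k i) * weighing k i by
        rcases Int.units_eq_one_or (ε i) with hε | hε <;> simp [h, hε], h4]
    norm_num

/-- Sign changes alter entries by multiples of 2, so modulo 2 only the inner products of the
weighing rows matter, and these are 0 or 4. -/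
theorem inner_scaledRootsK5_div_mem :
    ∀ r ∈ scaledRootsK5, ∀ r' ∈ scaledRootsK5, ⟪r, r'⟫ / (2 : ℕ) ∈ eisenstein := by
  have h1 : ∀ k, ∀ r' ∈ scaledRootsK5,
      ⟪(2 : ℂ) • EuclideanSpace.single k (1 : ℂ), r'⟫ / (2 : ℕ) ∈ eisenstein := fun k r' hr' => by
    rw [inner_two_smul_single_div]
    exact apply_mem_of_mem_scaledRootsK5 hr' k
  have h2 : ∀ (ε : ℤˣ) (z : ℂ), z ∈ eisenstein → (((ε : ℤ) : ℂ) * z - z) / 2 ∈ eisenstein := by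
    intro ε z hz
    rcases Int.units_eq_one_or ε with rfl | rfl
    · simp [zero_mem]
    · convert neg_mem hz using 1
      push_cast
      ring
  rintro r (⟨k, rfl⟩ | ⟨k, ε, h⟩) r' hr'
  · exact h1 k r' hr'
  rcases hr' with ⟨k', rfl⟩ | ⟨k', ε', h'⟩
  · have := conj_mem (h1 k' r (Or.inr ⟨k, ε, h⟩))
    rw [map_div₀, inner_conj_symm, map_natCast] at this
    exact this
  · have h3 : ∑ i, conj (weighing k i) * weighing k' i / 2 ∈ eisenstein := by
      rw [← Finset.sum_div, sum_conj_weighing_mul]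
      split_ifs
      · convert natCast_mem eisenstein 2 using 1
        norm_num
      · simp [zero_mem]
    have h4 := sum_mem (S := eisenstein) (t := Finset.univ)
      (f := fun i => (r' i - weighing k' i) / 2 * conj (r i) +
        weighing k' i * conj ((r i - weighing k i) / 2)) fun i _ => by
      refine add_mem (mul_mem ?_ (conj_mem ?_)) (mul_mem (weighing_mem k' i) (conj_mem ?_))
      · rw [h']; exact h2 _ _ (weighing_mem k' i)
      · exact apply_mem_of_mem_scaledRootsK5 (Or.inr ⟨k, ε, h⟩) i
      · rw [h]; exact h2 _ _ (weighing_mem k i)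
    convert add_mem h4 h3 using 1
    rw [inner_eq_sum, Finset.sum_div, ← Finset.sum_add_distrib]
    refine Finset.sum_congr rfl fun i _ => ?_
    rw [map_div₀, map_sub, Complex.conj_ofNat]
    push_cast
    ring

/-- The arithmetic of the squared norms of five entries, run over all 32 supports. Two nonzero
entries are excluded by hypothesis; three would give `1 + 1 + 1` or require a 2; five exceed the
bound. -/
theorem support_of_sum_le_four {a b c d e : ℕ} (hs : a + b + c + d + e ≤ 4)
    (h3 : a + b + c + d + e ≠ 3) (h2a : a ≠ 2) (h2b : b ≠ 2) (h2c : c ≠ 2) (h2d : d ≠ 2)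
    (h2e : e ≠ 2)
    (hab : c + d + e = 0 → a = 0 ∨ b = 0) (hac : b + d + e = 0 → a = 0 ∨ c = 0)
    (had : b + c + e = 0 → a = 0 ∨ d = 0) (hae : b + c + d = 0 → a = 0 ∨ e = 0)
    (hbc : a + d + e = 0 → b = 0 ∨ c = 0) (hbd : a + c + e = 0 → b = 0 ∨ d = 0)
    (hbe : a + c + d = 0 → b = 0 ∨ e = 0) (hcd : a + b + e = 0 → c = 0 ∨ d = 0)
    (hce : a + b + d = 0 → c = 0 ∨ e = 0) (hde : a + b + c = 0 → d = 0 ∨ e = 0) :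
    (a = 0 ∧ b = 0 ∧ c = 0 ∧ d = 0 ∨ a = 0 ∧ b = 0 ∧ c = 0 ∧ e = 0 ∨
      a = 0 ∧ b = 0 ∧ d = 0 ∧ e = 0 ∨ a = 0 ∧ c = 0 ∧ d = 0 ∧ e = 0 ∨
      b = 0 ∧ c = 0 ∧ d = 0 ∧ e = 0) ∨
    (a = 0 ∧ b = 1 ∧ c = 1 ∧ d = 1 ∧ e = 1 ∨ a = 1 ∧ b = 0 ∧ c = 1 ∧ d = 1 ∧ e = 1 ∨
      a = 1 ∧ b = 1 ∧ c = 0 ∧ d = 1 ∧ e = 1 ∨ a = 1 ∧ b = 1 ∧ c = 1 ∧ d = 0 ∧ e = 1 ∨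
      a = 1 ∧ b = 1 ∧ c = 1 ∧ d = 1 ∧ e = 0) := by
  rcases Nat.eq_zero_or_pos a with rfl | ha <;> rcases Nat.eq_zero_or_pos b with rfl | hb <;>
    rcases Nat.eq_zero_or_pos c with rfl | hc <;> rcases Nat.eq_zero_or_pos d with rfl | hd <;>
    rcases Nat.eq_zero_or_pos e with rfl | he
  all_goals first
    | (left; simp; done)
    | exact absurd (hab rfl) (by clear * - ha hb; omega)
    | exact absurd (hac rfl) (by clear * - ha hc; omega)
    | exact absurd (had rfl) (by clear * - ha hd; omega)
    | exact absurd (hae rfl) (by clear * - ha he; omega)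
    | exact absurd (hbc rfl) (by clear * - hb hc; omega)
    | exact absurd (hbd rfl) (by clear * - hb hd; omega)
    | exact absurd (hbe rfl) (by clear * - hb he; omega)
    | exact absurd (hcd rfl) (by clear * - hc hd; omega)
    | exact absurd (hce rfl) (by clear * - hc he; omega)
    | exact absurd (hde rfl) (by clear * - hd he; omega)
    | (exfalso; clear hab hac had hae hbc hbd hbe hcd hce hde; omega)
    | (right; clear hab hac had hae hbc hbd hbe hcd hce hde; omega)

/-- The short vectors of the lattice dual to `K₅` which are normal vectors of reflections. -/
theorem support_of_normal_K5 {v : EuclideanSpace ℂ (Fin 5)}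
    (hv : ∀ r ∈ scaledRootsK5, ⟪r, v⟫ / (2 : ℕ) ∈ eisenstein) (hn : ‖v‖ ^ 2 ≤ 4)
    (hn3 : ‖v‖ ^ 2 ≠ 3) :
    (∃ k, ∀ i, i ≠ k → v i = 0) ∨ ∃ k, v k = 0 ∧ (∀ i, i ≠ k → v i ≠ 0) ∧
      (v 0 = v 1 ∨ v 0 = -v 1 → v 2 = 0) := by
  have hO : ∀ k, v k ∈ eisenstein := fun k => by
    have := hv _ (Or.inl ⟨k, rfl⟩)
    rwa [inner_two_smul_single_div] at this
  have hrow : ∀ k, (∑ i, conj (weighing k i) * v i) / 2 ∈ eisenstein := fun k => by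
    have := hv (WithLp.toLp 2 (weighing k)) (Or.inr ⟨k, fun _ => 1, fun i => by simp⟩)
    rw [inner_eq_sum] at this
    simpa using this
  choose N hN hN4 using fun k => exists_norm_sq_eq (hO k)
  have hN0 : ∀ k, N k = 0 ↔ v k = 0 := fun k => by
    have := hN k
    constructor
    · intro h
      rw [h] at this
      simpa using this
    · intro h
      rw [h] at this
      have : (N k : ℝ) = 0 := by rw [← this]; simp
      exact_mod_cast this
  have hnorm : ‖v‖ ^ 2 = (N 0 + N 1 + N 2 + N 3 + N 4 : ℕ) := by
    rw [EuclideanSpace.norm_sq_eq, Fin.sum_univ_five]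
    simp only [hN]
    push_cast
    rfl
  rw [hnorm] at hn hn3
  have hs : N 0 + N 1 + N 2 + N 3 + N 4 ≤ 4 := by exact_mod_cast hn
  have hs3 : N 0 + N 1 + N 2 + N 3 + N 4 ≠ 3 := by exact_mod_cast hn3
  have hN2 : ∀ k, N k ≠ 2 := fun k h => by
    have := hN4 k (by rw [h]; exact even_two)
    omega
  have hquarter : ∀ (k : Fin 5) (z : ℂ), z ∈ eisenstein → ‖z‖ ^ 2 = N k / 4 → 4 ∣ N k := by
    intro k z hz hzn
    obtain ⟨m, hm, -⟩ := exists_norm_sq_eq hz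
    refine ⟨m, ?_⟩
    have : (N k : ℝ) = 4 * m := by rw [← hm, hzn]; ring
    exact_mod_cast this
  -- Row `i` vanishes at `i`, so it pairs with `v` to a unit times `v j / 2`.
  have hfour : ∀ i j, i ≠ j → (∀ l, l ≠ i → l ≠ j → v l = 0) → 4 ∣ N j := fun i j hij h => by
    have h1 := hrow i
    rw [Finset.sum_eq_single j (fun l _ hl => by
      by_cases hli : l = i
      · simp [hli, weighing]
      · rw [h l hli hl, mul_zero]) (by simp)] at h1
    refine hquarter j _ h1 ?_
    have h2 : ‖weighing i j‖ = 1 := by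
      rw [weighing, if_neg hij.symm, norm_pow,
        isPrimitiveRoot_omega.norm'_eq_one (by norm_num), one_pow]
    rw [norm_div, norm_mul, Complex.norm_conj, h2, one_mul, div_pow, hN]
    norm_num
  have hpair : ∀ i j a b c, i ≠ j → (∀ l, l ≠ i → l ≠ j → l = a ∨ l = b ∨ l = c) →
      N a + N b + N c = 0 → N i = 0 ∨ N j = 0 := by
    intro i j a b c hij h h0
    have h1 : ∀ l, l ≠ i → l ≠ j → v l = 0 := fun l hi hj => by
      rw [← hN0]
      rcases h l hi hj with rfl | rfl | rfl <;> omega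
    have h2 := hfour j i hij.symm fun l hj hi => h1 l hi hj
    have h3 := hfour i j hij h1
    have h4 : N i + N j ≤ 4 := by
      rw [← Fin.sum_univ_five] at hs
      rw [← Finset.sum_pair hij]
      exact (Finset.sum_le_sum_of_subset (Finset.subset_univ _)).trans hs
    omega
  have hcases := support_of_sum_le_four hs hs3 (hN2 0) (hN2 1) (hN2 2) (hN2 3) (hN2 4)
    (hpair 0 1 2 3 4 (by decide) (by decide)) (hpair 0 2 1 3 4 (by decide) (by decide))
    (hpair 0 3 1 2 4 (by decide) (by decide)) (hpair 0 4 1 2 3 (by decide) (by decide))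
    (hpair 1 2 0 3 4 (by decide) (by decide)) (hpair 1 3 0 2 4 (by decide) (by decide))
    (hpair 1 4 0 2 3 (by decide) (by decide)) (hpair 2 3 0 1 4 (by decide) (by decide))
    (hpair 2 4 0 1 3 (by decide) (by decide)) (hpair 3 4 0 1 2 (by decide) (by decide))
  -- The squared norm would be `3/4`.
  have hodd : ∀ k, N k = 1 → (1 - ω) * v k / 2 ∉ eisenstein := fun k hk h => by
    obtain ⟨m, hm, -⟩ := exists_norm_sq_eq h
    rw [norm_div, norm_mul, div_pow, mul_pow, norm_one_sub_omega_sq, hN, hk] at hm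
    have h1 : (3 : ℝ) = 4 * m := by
      rw [← hm]; norm_num
    have h2 : 3 = 4 * m := by exact_mod_cast h1
    omega
  have hhalf : v 0 = v 1 ∨ v 0 = -v 1 → (v 0 - v 1) / 2 ∈ eisenstein := by
    rintro (h | h)
    · rw [h, sub_self, zero_div]; exact zero_mem _
    · convert neg_mem (hO 1) using 1
      rw [h]; ring
  have hrow0 : (v 1 + v 2 + v 3 + v 4) / 2 ∈ eisenstein := by
    convert hrow 0 using 2
    simp [Fin.sum_univ_five, weighing, phase]
  have hrow1 : (v 0 + v 2 + (-1 - ω) * v 3 + ω * v 4) / 2 ∈ eisenstein := by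
    convert hrow 1 using 2
    simp [Fin.sum_univ_five, weighing, phase, conj_omega]
    left
    linear_combination -omega_sq
  rcases hcases with h | h
  · left
    have hk : ∀ k, (∀ i, i ≠ k → N i = 0) → ∃ k, ∀ i, i ≠ k → v i = 0 :=
      fun k h => ⟨k, fun i hi => (hN0 i).1 (h i hi)⟩
    rcases h with ⟨h1, h2, h3, h4⟩ | ⟨h1, h2, h3, h4⟩ | ⟨h1, h2, h3, h4⟩ | ⟨h1, h2, h3, h4⟩ |
      ⟨h1, h2, h3, h4⟩
    · exact hk 4 fun i hi => by
        fin_cases i <;> first | exact absurd rfl hi | exact h1 | exact h2 | exact h3 | exact h4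
    · exact hk 3 fun i hi => by
        fin_cases i <;> first | exact absurd rfl hi | exact h1 | exact h2 | exact h3 | exact h4
    · exact hk 2 fun i hi => by
        fin_cases i <;> first | exact absurd rfl hi | exact h1 | exact h2 | exact h3 | exact h4
    · exact hk 1 fun i hi => by
        fin_cases i <;> first | exact absurd rfl hi | exact h1 | exact h2 | exact h3 | exact h4
    · exact hk 0 fun i hi => by
        fin_cases i <;> first | exact absurd rfl hi | exact h1 | exact h2 | exact h3 | exact h4
  · right
    have hk : ∀ k, N k = 0 → (∀ i, i ≠ k → N i = 1) → (v 0 = v 1 ∨ v 0 = -v 1 → v 2 = 0) →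
        ∃ k, v k = 0 ∧ (∀ i, i ≠ k → v i ≠ 0) ∧ (v 0 = v 1 ∨ v 0 = -v 1 → v 2 = 0) :=
      fun k h0 h1 h2 => ⟨k, (hN0 k).1 h0, fun i hi hvi => by
        have h3 := h1 i hi
        rw [(hN0 i).2 hvi] at h3
        exact zero_ne_one h3, h2⟩
    rcases h with ⟨h0, h1, h2, h3, h4⟩ | ⟨h0, h1, h2, h3, h4⟩ | ⟨h0, h1, h2, h3, h4⟩ |
      ⟨h0, h1, h2, h3, h4⟩ | ⟨h0, h1, h2, h3, h4⟩
    · have hz := (hN0 0).1 h0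
      refine hk 0 h0 (fun i hi => by
        fin_cases i <;> first | exact absurd rfl hi | exact h0 | exact h1 | exact h2 | exact h3 |
          exact h4) fun h' => ?_
      have : v 1 = 0 := by rcases h' with h' | h' <;> simpa [hz] using h'.symm
      have := (hN0 1).2 this
      omega
    · have hz := (hN0 1).1 h1
      refine hk 1 h1 (fun i hi => by
        fin_cases i <;> first | exact absurd rfl hi | exact h0 | exact h1 | exact h2 | exact h3 |
          exact h4) fun h' => ?_
      have : v 0 = 0 := by rcases h' with h' | h' <;> simpa [hz] using h'
      have := (hN0 0).2 this
      omega
    · have hz := (hN0 2).1 h2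
      exact hk 2 h2 (fun i hi => by
        fin_cases i <;> first | exact absurd rfl hi | exact h0 | exact h1 | exact h2 | exact h3 |
          exact h4) fun _ => hz
    · have hz := (hN0 3).1 h3
      refine hk 3 h3 (fun i hi => by
        fin_cases i <;> first | exact absurd rfl hi | exact h0 | exact h1 | exact h2 | exact h3 |
          exact h4) fun h' => ?_
      refine absurd ?_ (hodd 4 h4)
      -- Row 0 minus row 1 plus `(v 0 - v 1) / 2` cancels the first three entries and leaves `((2 +
      -- ω) * v 3 + (1 - ω) * v 4) / 2`.
      convert add_mem (sub_mem hrow0 hrow1) (hhalf h') using 1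
      rw [hz]
      ring
    · have hz := (hN0 4).1 h4
      refine hk 4 h4 (fun i hi => by
        fin_cases i <;> first | exact absurd rfl hi | exact h0 | exact h1 | exact h2 | exact h3) fun h' => ?_
      refine absurd ?_ (hodd 3 h3)
      -- The unit `-ω` turns the coefficient `2 + ω` into `1 - ω`.
      convert mul_mem (neg_mem omega_mem) (add_mem (sub_mem hrow0 hrow1) (hhalf h')) using 1
      rw [hz]
      linear_combination v 3 / 2 * omega_sq

theorem exists_normal_of_mem_G33 {H : Submodule ℂ (EuclideanSpace ℂ (Fin 5))}
    (hH : H ∈ reflectionArrangement G33) : ∃ v, v ≠ 0 ∧ H = (ℂ ∙ v)ᗮ ∧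
      ((∃ k, ∀ i, i ≠ k → v i = 0) ∨ ∃ k, v k = 0 ∧ (∀ i, i ≠ k → v i ≠ 0) ∧
        (v 0 = v 1 ∨ v 0 = -v 1 → v 2 = 0)) := by
  obtain ⟨g, hg, hgr, rfl⟩ := hH
  obtain ⟨v, hv0, hgv, hv, τ, hτ, hτ0, hle, m, hm⟩ :=
    exists_normal_of_isReflection (R := scaledRootsK5) two_pos inner_self_scaledRootsK5
      inner_scaledRootsK5_div_mem (fun x hx k => by
        have := hx _ (Or.inl ⟨k, rfl⟩)
        rwa [inner_two_smul_single_div] at this) (by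
        rintro v (⟨k, rfl⟩ | ⟨k, ε, hk, h⟩)
        · exact ⟨2, two_ne_zero, Or.inl ⟨k, rfl⟩⟩
        · refine ⟨1, one_ne_zero, Or.inr ⟨k, ε, fun i => ?_⟩⟩
          rw [one_smul, weighing]
          split_ifs with hik
          · rw [hik, hk, mul_zero]
          · exact h i hik) hg hgr
  have h1 := one_le_norm_sq hτ hτ0
  have h2 : 1 ≤ ‖τ‖ := by nlinarith [norm_nonneg τ]
  push_cast at hle hm
  refine ⟨v, hv0, hgv, support_of_normal_K5 hv (by nlinarith [sq_nonneg ‖v‖]) fun h3 => ?_⟩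
  rw [h3] at hle hm
  -- If `‖v‖² = 3`, the bound forces `‖τ‖ = 1`, and the integrality of `‖τ‖² * ‖v‖² / 2` fails.
  obtain ⟨t, ht, -⟩ := exists_norm_sq_eq hτ
  have h4 : ‖τ‖ ^ 2 < 2 := by nlinarith [norm_nonneg τ]
  rw [ht] at h1 h4 hm
  have h5 : t = 1 := by
    have : 1 ≤ t := by exact_mod_cast h1
    have : t < 2 := by exact_mod_cast h4
    omega
  rw [h5] at hm
  have h6 : ((3 : ℤ) : ℝ) = ((2 * m : ℤ) : ℝ) := by push_cast at hm ⊢; linarith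
  have h7 : (3 : ℤ) = 2 * m := by exact_mod_cast h6
  omega

theorem orthogonal_single_mem_G33 (k : Fin 5) :
    (ℂ ∙ EuclideanSpace.single k (1 : ℂ))ᗮ ∈ reflectionArrangement G33 :=
  orthogonal_mem_reflectionArrangement (by simp)
    (Subgroup.subset_closure ⟨_, Or.inl ⟨k, rfl⟩, by simp, rfl⟩)

theorem orthogonal_weighing_mem_G33 (k : Fin 5) (ε : Fin 5 → ℤˣ) :
    (ℂ ∙ (WithLp.toLp 2 fun i => ((ε i : ℤ) : ℂ) * weighing k i : EuclideanSpace ℂ (Fin 5)))ᗮ ∈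
      reflectionArrangement G33 := by
  have h0 : (WithLp.toLp 2 fun i => ((ε i : ℤ) : ℂ) * weighing k i :
      EuclideanSpace ℂ (Fin 5)) ≠ 0 := fun h => by
    obtain ⟨i, hi⟩ := exists_ne k
    have h1 := congrArg (fun v : EuclideanSpace ℂ (Fin 5) => v i) h
    rcases Int.units_eq_one_or (ε i) with hε | hε <;>
      simp [hε, weighing_ne_zero hi] at h1
  refine orthogonal_mem_reflectionArrangement h0 (Subgroup.subset_closure ⟨_, Or.inr
    ⟨k, ε, by simp [weighing], fun i hi => by simp [weighing, hi]⟩, h0, rfl⟩)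

theorem isVertex_single_G33 (k : Fin 5) :
    IsVertex (reflectionArrangement G33) (EuclideanSpace.single k (1 : ℂ)) := fun x hx => by
  refine ⟨x k, ?_⟩
  ext i
  by_cases hik : i = k
  · subst hik; simp
  · have := hx _ (orthogonal_single_mem_G33 i)
    rw [Submodule.mem_orthogonal_singleton_iff_inner_right,
      Submodule.mem_orthogonal_singleton_iff_inner_right, EuclideanSpace.inner_single_left,
      EuclideanSpace.inner_single_left] at this
    simpa [hik] using this

/-- The other three coordinate hyperplanes cut out the plane of `e_k` and `e_d`, and the hyperplane
normal to `w` cuts that plane in a line. -/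
theorem isVertex_G33 {w : EuclideanSpace ℂ (Fin 5)}
    (hw : (ℂ ∙ w)ᗮ ∈ reflectionArrangement G33) {k d : Fin 5} (hkd : k ≠ d) (hk : w k ≠ 0) :
    IsVertex (reflectionArrangement G33) (EuclideanSpace.single k (conj (w d)) -
      EuclideanSpace.single d (conj (w k))) := fun x hx => by
  have hk' : conj (w k) ≠ 0 := by simpa using hk
  have h0 : ∀ i, i ≠ k → i ≠ d → x i = 0 := fun i hik hid => by
    have := hx _ (orthogonal_single_mem_G33 i)
    rw [Submodule.mem_orthogonal_singleton_iff_inner_right,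
      Submodule.mem_orthogonal_singleton_iff_inner_right, EuclideanSpace.inner_single_left,
      EuclideanSpace.inner_single_left] at this
    simpa [hik, hid] using this
  have h1 : conj (w k) * x k + conj (w d) * x d = 0 := by
    have := hx _ hw
    rw [Submodule.mem_orthogonal_singleton_iff_inner_right,
      Submodule.mem_orthogonal_singleton_iff_inner_right, inner_sub_right,
      EuclideanSpace.inner_single_right, EuclideanSpace.inner_single_right, inner_eq_sum,
      Finset.sum_eq_add k d hkd (fun i _ hi => by rw [h0 i hi.1 hi.2, mul_zero]) (by simp)
        (by simp)] at this
    exact this (by ring)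
  refine ⟨-(x d / conj (w k)), ?_⟩
  ext i
  by_cases hik : i = k
  · subst hik
    simp [hkd]
    field_simp
    linear_combination h1
  · by_cases hid : i = d
    · subst hid
      simp [hkd.symm]
      field_simp
    · simp [hik, hid, h0 i hik hid]

theorem not_exists_modular_G33 :
    ¬ ∃ X, IsModularElement (reflectionArrangement G33) X ∧ rank X = 2 := by
  rintro ⟨X, hX, hrk⟩
  have hP := finrank_orthogonal_of_rank hrk
  have hroot : ∀ y, IsVertex (reflectionArrangement G33) y → ∃ v ∈ Xᗮ, v ≠ 0 ∧ ⟪v, y⟫ = 0 ∧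
      ((∃ k, ∀ i, i ≠ k → v i = 0) ∨ ∃ k, v k = 0 ∧ (∀ i, i ≠ k → v i ≠ 0) ∧
        (v 0 = v 1 ∨ v 0 = -v 1 → v 2 = 0)) := fun y hy => by
    obtain ⟨H, hHA, hXH, hyH⟩ := hX.exists_mem hrk hy
    obtain ⟨v, hv0, rfl, hv⟩ := exists_normal_of_mem_G33 hHA
    exact ⟨v, mem_orthogonal_of_le hXH, hv0,
      Submodule.mem_orthogonal_singleton_iff_inner_right.1 hyH, hv⟩
  have hzero : ∀ k, ∃ v ∈ Xᗮ, v ≠ 0 ∧ v k = 0 ∧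
      ((∃ k, ∀ i, i ≠ k → v i = 0) ∨ ∃ k, v k = 0 ∧ (∀ i, i ≠ k → v i ≠ 0) ∧
        (v 0 = v 1 ∨ v 0 = -v 1 → v 2 = 0)) := fun k => by
    obtain ⟨v, hvP, hv0, hvk, hv⟩ := hroot _ (isVertex_single_G33 k)
    refine ⟨v, hvP, hv0, ?_, hv⟩
    rw [EuclideanSpace.inner_single_right] at hvk
    simpa using hvk
  -- Either the normal plane contains a coordinate vector, or all the normals it supplies have four
  -- nonzero entries.
  by_cases hsingle : ∃ v ∈ Xᗮ, v ≠ 0 ∧ ∃ k, ∀ i, i ≠ k → v i = 0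
  · obtain ⟨v, hvP, hv0, k, hvk⟩ := hsingle
    have hvk0 : v k ≠ 0 := fun h => hv0 (by
      ext i
      by_cases hik : i = k
      · rw [hik, h]; rfl
      · rw [hvk i hik]; rfl)
    obtain ⟨c, hcP, hc0, hck, hc⟩ := hzero k
    obtain ⟨d, hcd⟩ : ∃ d, c d ≠ 0 := by
      by_contra! h
      exact hc0 (by ext i; simpa using h i)
    have hdk : d ≠ k := by rintro rfl; exact hcd hck
    -- Row `a` is nonzero at both `k` and `d`, so the resulting line demands a normal `u` nonzero at
    -- both, hence one with four nonzero entries.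
    obtain ⟨a, hak, had⟩ : ∃ a : Fin 5, k ≠ a ∧ d ≠ a := by
      clear * -
      revert k d
      decide
    have hwa := orthogonal_weighing_mem_G33 a 1
    have hwk := weighing_ne_zero hak
    have hwd := weighing_ne_zero had
    obtain ⟨u, huP, hu0, huy, hu⟩ := hroot _ (isVertex_G33 hwa hdk.symm (by simpa using hwk))
    rw [inner_sub_right, EuclideanSpace.inner_single_right,
      EuclideanSpace.inner_single_right] at huy
    simp only [Pi.one_apply, Units.val_one, Int.cast_one, one_mul] at huy
    have huy' : weighing a d * u k = weighing a k * u d := by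
      have := congrArg conj huy
      simp at this
      linear_combination this
    obtain ⟨s, t, hst⟩ := exists_eq_smul_add_smul hP hvP hcP (fun s t h => by
      have e1 := congrArg (fun v : EuclideanSpace ℂ (Fin 5) => v k) h
      have e2 := congrArg (fun v : EuclideanSpace ℂ (Fin 5) => v d) h
      simp [hvk d hdk, hck, hcd, hvk0] at e1 e2
      exact ⟨e1, e2⟩) huP
    have hui : ∀ i, i ≠ k → u i = t * c i := fun i hi => by
      rw [hst]; simp [hvk i hi]
    have ht0 : t ≠ 0 := fun ht => by
      have h1 : u d = 0 := by rw [hui d hdk, ht, zero_mul]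
      have h2 : u k = 0 := by
        rw [h1, mul_zero] at huy'
        exact (mul_eq_zero.1 huy').resolve_left hwd
      apply hu0
      ext i
      by_cases hik : i = k
      · rw [hik, h2]; rfl
      · rw [hui i hik, ht, zero_mul]; rfl
    have hud0 : u d ≠ 0 := by rw [hui d hdk]; exact mul_ne_zero ht0 hcd
    have huk0 : u k ≠ 0 := fun h => by
      rw [h, mul_zero] at huy'
      exact mul_ne_zero hwk hud0 huy'.symm
    have hu2 : ∃ j, u j = 0 ∧ ∀ i, i ≠ j → u i ≠ 0 := by
      rcases hu with ⟨j, hj⟩ | ⟨j, hj, hj', -⟩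
      · exfalso
        by_cases hjk : k = j
        · exact hud0 (hj d (hjk ▸ hdk))
        · exact huk0 (hj k hjk)
      · exact ⟨j, hj, hj'⟩
    obtain ⟨j, hj, hj'⟩ := hu2
    have hjk : j ≠ k := by rintro rfl; exact huk0 hj
    have hcj : c j = 0 := by
      rw [hui j hjk] at hj
      exact (mul_eq_zero.1 hj).resolve_left ht0
    -- Away from `k`, `u` is a nonzero multiple of `c`. If `c` has one nonzero entry, `u` has too
    -- few; if `c` has four, its only zero is at `k`, so `u` has no zero.
    rcases hc with ⟨l, hl⟩ | ⟨l, hl, hl', -⟩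
    · have hld : d = l := by
        by_contra h
        exact hcd (hl d h)
      obtain ⟨i, hik, hid, hij⟩ : ∃ i : Fin 5, i ≠ k ∧ i ≠ d ∧ i ≠ j := by
        clear * -
        revert k d j
        decide
      apply hj' i hij
      rw [hui i hik, hl i (hld ▸ hid), mul_zero]
    · have h1 : k = l := by
        by_contra h
        exact hl' k h hck
      exact hl' j (h1 ▸ hjk) hcj
  · have hfour : ∀ v ∈ Xᗮ, v ≠ 0 → ((∃ k, ∀ i, i ≠ k → v i = 0) ∨ ∃ k, v k = 0 ∧
        (∀ i, i ≠ k → v i ≠ 0) ∧ (v 0 = v 1 ∨ v 0 = -v 1 → v 2 = 0)) → ∃ k, v k = 0 ∧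
        (∀ i, i ≠ k → v i ≠ 0) ∧ (v 0 = v 1 ∨ v 0 = -v 1 → v 2 = 0) :=
      fun v hv hv0 h => h.resolve_left fun h' => hsingle ⟨v, hv, hv0, h'⟩
    -- Row 2 has entries 1 at 0 and 1, so flipping one sign demands a normal with `v 1 = ± v 0`,
    -- whose zero must then be at 2.
    have hsign : ∀ ε : ℤˣ, ∃ v ∈ Xᗮ, v 1 = ((ε : ℤ) : ℂ) * v 0 ∧ v 0 ≠ 0 ∧ v 2 = 0 := by
      intro ε
      have hw := orthogonal_weighing_mem_G33 2 (fun i => if i = 1 then ε else 1)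
      obtain ⟨v, hvP, hv0, hvy, hv⟩ := hroot _ (isVertex_G33 hw (k := 0) (d := 1) (by decide)
        (by simp [weighing, phase]))
      obtain ⟨k, hk, hk', hk2⟩ := hfour v hvP hv0 hv
      rw [inner_sub_right, EuclideanSpace.inner_single_right,
        EuclideanSpace.inner_single_right] at hvy
      have h1 : v 1 = ((ε : ℤ) : ℂ) * v 0 := by
        have := congrArg conj hvy
        simp [weighing, phase] at this
        linear_combination -this
      have h2 : v 2 = 0 := hk2 (by
        rcases Int.units_eq_one_or ε with rfl | rfl
        · left; simpa using h1.symm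
        · right; rw [h1]; simp)
      have hk2' : 2 = k := by
        by_contra h
        exact hk' 2 h h2
      exact ⟨v, hvP, h1, hk' 0 (by rw [← hk2']; decide), h2⟩
    obtain ⟨p, hpP, hp1, hp0, hp2⟩ := hsign 1
    obtain ⟨q, hqP, hq1, hq0, hq2⟩ := hsign (-1)
    obtain ⟨u, huP, hu0, hu, huc⟩ := hzero 0
    obtain ⟨k, hk, hk', -⟩ := hfour u huP hu0 huc
    -- The two signs make `p` and `q` independent, so the whole plane vanishes at 2. But `u` already
    -- has its only zero at 0.
    obtain ⟨s, t, rfl⟩ := exists_eq_smul_add_smul hP hpP hqP (fun s t h => by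
      have e1 := congrArg (fun v : EuclideanSpace ℂ (Fin 5) => v 0) h
      have e2 := congrArg (fun v : EuclideanSpace ℂ (Fin 5) => v 1) h
      simp [hp1, hq1] at e1 e2
      have e3 : s * p 0 = 0 := by linear_combination (e1 + e2) / 2
      have e4 : t * q 0 = 0 := by linear_combination (e1 - e2) / 2
      exact ⟨(mul_eq_zero.1 e3).resolve_right hp0, (mul_eq_zero.1 e4).resolve_right hq0⟩) huP
    have h0k : 0 = k := by
      by_contra h
      exact hk' 0 h hu
    exact hk' 2 (by rw [← h0k]; decide) (by simp [hp2, hq2])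

end K5

end ReflectionArrangement
end

theorem lemma3p6 {V : Type*} [AddCommGroup V] [Module ℂ V] (W : Subgroup (V ≃ₗ[ℂ] V))
    (hW : (∃ r l : ℕ, 3 ≤ r ∧ 5 ≤ l ∧
        ReflectionArrangement.IsLinearlyConjugate W (ReflectionArrangement.monomialGroup r l)) ∨
      ReflectionArrangement.IsLinearlyConjugate W ReflectionArrangement.G33 ∨
      ReflectionArrangement.IsLinearlyConjugate W ReflectionArrangement.G34) :
    ¬ ∃ X : Submodule ℂ V,
      ReflectionArrangement.IsModularElement
        (ReflectionArrangement.reflectionArrangement W) X ∧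
      ReflectionArrangement.rank X = 2 := by
  intro hX
  rcases hW with ⟨r, l, hr, hl, h⟩ | h | h
  · exact ReflectionArrangement.not_exists_modular_monomialGroup hr hl (h.exists_modular hX)
  · exact ReflectionArrangement.not_exists_modular_G33 (h.exists_modular hX)
  · exact ReflectionArrangement.not_exists_modular_G34 (h.exists_modular hX)
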